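/- Let $K$ be an algebraically closed field of characteristic $0$. A quadratic Lie superalgebra over $K$ is a Lie superalgebra $\mathfrak g=\mathfrak g_{\bar 0}\oplus\mathfrak g_{\bar 1}$ together with a nondegenerate bilinear form $B$ that is even ($B(\mathfrak g_{\bar 0},\mathfrak g_{\bar 1})=0$), supersymmetric ($B(X,Y)=(-1)^{xy}B(Y,X)$ for $X\in\mathfrak g_x$, $Y\in\mathfrak g_y$) and invariant ($B([X,Y],Z)=B(X,[Y,Z])$ for all $X,Y,Z$). An isometry of quadratic Lie superalgebras is an isomorphism of Lie superalgebras (preserving degrees and brackets) that preserves the forms. A subspace $P$ is totally isotropic if $B(P,P)=0$. For a finite-dimensional Lie superalgebra $\mathfrak h$, grade $\mathfrak h^*$ by letting $\mathfrak h^*_f$ be the set of linear forms vanishing on $\mathfrak h_{f+\bar 1}$, and let $\pi$ be the coadjoint representation, $(\pi(X)F)(Y)=-(-1)^{xf}F([X,Y])$ for $X\in\mathfrak h_x$, $F\in\mathfrak h^*_f$. A supercyclic even $2$-cocycle is a bilinear map $\omega:\mathfrak h\times\mathfrak h\to\mathfrak h^*$ with $\omega(\mathfrak h_x,\mathfrak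 h_y)\subset\mathfrak h^*_{x+y}$ such that for all $X\in\mathfrak h_x$, $Y\in\mathfrak h_y$, $Z\in\mathfrak h_z$: $$\omega(X,Y)=-(-1)^{xy}\omega(Y,X),\qquad \omega(X,Y)(Z)=(-1)^{x(y+z)}\omega(Y,Z)(X),$$ $$\begin{aligned}&\omega(X,[Y,Z])+(-1)^{x(y+z)}\omega(Y,[Z,X])+(-1)^{z(x+y)}\omega(Z,[X,Y])\\&\quad+\pi(X)\omega(Y,Z)+(-1)^{x(y+z)}\pi(Y)\omega(Z,X)+(-1)^{z(x+y)}\pi(Z)\omega(X,Y)=0.\end{aligned}$$ The $T^*$-extension $T^*_\omega\mathfrak h$ is the quadratic Lie superalgebra with underlying graded space $\mathfrak h\oplus\mathfrak h^*$ (so that its component of degree $x$ is $\mathfrak h_x\oplus\mathfrak h^*_x$) and, for $X+F$, $Y+H$ homogeneous of degrees $x,y$, $$[X+F,Y+H]=[X,Y]+\omega(X,Y)+\pi(X)H-(-1)^{xy}\pi(Y)F,\qquad B(X+F,Y+H)=F(Y)+(-1)^{xy}H(X).$$ **Theorem.** Let $(\mathfrak g,B)$ be a finite-dimensional quadratic Lie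 superalgebra over $K$. Assume that $\mathfrak g$ is nilpotent, or that $\mathfrak g$ is solvable and $[\mathfrak g_{\bar 1},\mathfrak g_{\bar 1}]\subset[\mathfrak g_{\bar 0},\mathfrak g_{\bar 0}]$. Then $\mathfrak g$ contains a totally isotropic graded ideal $\mathfrak I$ of dimension $\lfloor\dim\mathfrak g/2\rfloor$ that is maximal among all totally isotropic subspaces of $\mathfrak g$ and such that: 1. if $\dim\mathfrak g$ is even, then $(\mathfrak g,B)$ is isometric to $T^*_\omega(\mathfrak g/\mathfrak I)$ for some supercyclic even $2$-cocycle $\omega$ of $\mathfrak g/\mathfrak I$; 2. if $\dim\mathfrak g$ is odd, then there are a supercyclic even $2$-cocycle $\omega$ of $\mathfrak g/\mathfrak I$ and a graded ideal $\mathfrak J$ of codimension $1$ in $T^*_\omega(\mathfrak g/\mathfrak I)$, on which the form of $T^*_\omega(\mathfrak g/\mathfrak I)$ restricts to a nondegenerate form, such that $(\mathfrak g,B)$ is isometric to $\mathfrak J$ with the restricted form. -/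

import Mathlib

/-- The sign `(-1)^{ij}` for two degrees `i, j` in `ℤ/2ℤ`. -/
def superSign (K : Type*) [Field K] (i j : ZMod 2) : K := (-1) ^ (i.val * j.val)

section SuperSign

variable {K : Type*} [Field K]

theorem zmodTwo_cases (i : ZMod 2) : i = 0 ∨ i = 1 := by
  revert i; decide

theorem zmodTwo_one_add_one : (1 + 1 : ZMod 2) = 0 := by decide

theorem zmodTwo_sum {M : Type*} [AddCommMonoid M] (f : ZMod 2 → M) :
    ∑ i : ZMod 2, f i = f 0 + f 1 := Fin.sum_univ_two f

theorem superSign_zero_left (j : ZMod 2) : superSign K 0 j = 1 := by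
  simp [superSign]

theorem superSign_zero_right (i : ZMod 2) : superSign K i 0 = 1 := by
  simp [superSign]

theorem superSign_one_one : superSign K 1 1 = -1 := by
  have h : (1 : ZMod 2).val = 1 := rfl
  simp [superSign, h]

end SuperSign

/-- A Lie superalgebra structure on the `K`-vector space `V`: a `ℤ/2ℤ`-grading `V = V_0 ⊕ V_1`
and a bilinear even bracket that is super-antisymmetric and satisfies the super Jacobi identity.
(This is the usual definition over fields of characteristic different from `2` and `3`.) -/
structure LieSuperalgebra (K V : Type*) [Field K] [AddCommGroup V] [Module K V] where
  grade : ZMod 2 → Submodule K V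
  isCompl_grade : IsCompl (grade 0) (grade 1)
  bracket : V →ₗ[K] V →ₗ[K] V
  bracket_mem : ∀ (i j : ZMod 2) (x y : V), x ∈ grade i → y ∈ grade j →
    bracket x y ∈ grade (i + j)
  bracket_skew : ∀ (i j : ZMod 2) (x y : V), x ∈ grade i → y ∈ grade j →
    bracket x y = -(superSign K i j • bracket y x)
  jacobi : ∀ (i j k : ZMod 2) (x y z : V), x ∈ grade i → y ∈ grade j → z ∈ grade k →
    bracket x (bracket y z) = bracket (bracket x y) z + superSign K i j • bracket y (bracket x z)

namespace LieSuperalgebra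

variable {K V W : Type*} [Field K] [AddCommGroup V] [Module K V] [AddCommGroup W] [Module K W]

theorem isCompl_grade_add_one (L : LieSuperalgebra K V) (i : ZMod 2) :
    IsCompl (L.grade i) (L.grade (i + 1)) := by
  rcases zmodTwo_cases i with rfl | rfl
  · simpa using L.isCompl_grade
  · simpa [zmodTwo_one_add_one] using L.isCompl_grade.symm

/-- The projection of `V` onto its homogeneous component of degree `i`. -/
noncomputable def proj (L : LieSuperalgebra K V) (i : ZMod 2) : V →ₗ[K] V :=
  (L.grade i).projection (L.grade (i + 1)) (L.isCompl_grade_add_one i)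

theorem proj_mem (L : LieSuperalgebra K V) (i : ZMod 2) (x : V) : L.proj i x ∈ L.grade i :=
  Submodule.projection_apply_mem _ x

theorem proj_of_mem (L : LieSuperalgebra K V) {i : ZMod 2} {x : V} (hx : x ∈ L.grade i) :
    L.proj i x = x :=
  Submodule.projection_apply_left (L.isCompl_grade_add_one i) ⟨x, hx⟩

theorem proj_of_mem_add_one (L : LieSuperalgebra K V) {i : ZMod 2} {x : V}
    (hx : x ∈ L.grade (i + 1)) : L.proj i x = 0 :=
  (Submodule.projection_apply_eq_zero_iff (L.isCompl_grade_add_one i)).2 hx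

theorem proj_zero_of_mem (L : LieSuperalgebra K V) {x : V} (hx : x ∈ L.grade 1) :
    L.proj 0 x = 0 := L.proj_of_mem_add_one (by simpa using hx)

theorem proj_one_of_mem (L : LieSuperalgebra K V) {x : V} (hx : x ∈ L.grade 0) :
    L.proj 1 x = 0 := L.proj_of_mem_add_one (by simpa [zmodTwo_one_add_one] using hx)

theorem proj_add_proj (L : LieSuperalgebra K V) (x : V) : L.proj 0 x + L.proj 1 x = x := by
  obtain ⟨a, ha, b, hb, rfl⟩ : ∃ a ∈ L.grade 0, ∃ b ∈ L.grade 1, a + b = x := by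
    have : x ∈ L.grade 0 ⊔ L.grade 1 := by rw [L.isCompl_grade.sup_eq_top]; trivial
    simpa [Submodule.mem_sup] using this
  simp [L.proj_of_mem ha, L.proj_of_mem hb, L.proj_zero_of_mem hb, L.proj_one_of_mem ha]

/-! ### Nilpotency and solvability -/

/-- `[P, Q]`: the span of all brackets `[x, y]` with `x ∈ P` and `y ∈ Q`. -/
def bracketSpan (L : LieSuperalgebra K V) (P Q : Submodule K V) : Submodule K V :=
  Submodule.map₂ L.bracket P Q

/-- The descending central series `C⁰ = 𝔤`, `Cⁿ⁺¹ = [𝔤, Cⁿ]`. -/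
def lowerCentral (L : LieSuperalgebra K V) : ℕ → Submodule K V
  | 0 => ⊤
  | n + 1 => L.bracketSpan ⊤ (L.lowerCentral n)

/-- The derived series `D⁰ = 𝔤`, `Dⁿ⁺¹ = [Dⁿ, Dⁿ]`. -/
def derived (L : LieSuperalgebra K V) : ℕ → Submodule K V
  | 0 => ⊤
  | n + 1 => L.bracketSpan (L.derived n) (L.derived n)

def IsNilpotent (L : LieSuperalgebra K V) : Prop := ∃ n, L.lowerCentral n = ⊥

def IsSolvable (L : LieSuperalgebra K V) : Prop := ∃ n, L.derived n = ⊥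

/-! ### Invariant scalar products and isometries -/

/-- `B` is an invariant scalar product on the Lie superalgebra: even, supersymmetric, invariant
and nondegenerate. A pair `(L, B)` with this property is a quadratic Lie superalgebra. -/
structure IsInvariantScalarProduct (L : LieSuperalgebra K V) (B : LinearMap.BilinForm K V) :
    Prop where
  even : ∀ x ∈ L.grade 0, ∀ y ∈ L.grade 1, B x y = 0
  supersymm : ∀ (i j : ZMod 2) (x y : V), x ∈ L.grade i → y ∈ L.grade j →
    B x y = superSign K i j * B y x
  invariant : ∀ x y z : V, B (L.bracket x y) z = B x (L.bracket y z)
  nondegenerate : B.Nondegenerate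

/-- `(L, B)` and `(L', B')` are isometric: there is an isomorphism of Lie superalgebras
(a bijective linear map that preserves degrees and brackets) carrying `B` to `B'`. -/
def IsIsometric (L : LieSuperalgebra K V) (B : LinearMap.BilinForm K V)
    (L' : LieSuperalgebra K W) (B' : LinearMap.BilinForm K W) : Prop :=
  ∃ φ : V ≃ₗ[K] W,
    (∀ (i : ZMod 2), ∀ x ∈ L.grade i, φ x ∈ L'.grade i) ∧
    (∀ x y : V, φ (L.bracket x y) = L'.bracket (φ x) (φ y)) ∧
    (∀ x y : V, B' (φ x) (φ y) = B x y)

/-- The subspace `P` is totally isotropic: `B(P, P) = 0`. -/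
def IsTotallyIsotropic (B : LinearMap.BilinForm K V) (P : Submodule K V) : Prop :=
  ∀ x ∈ P, ∀ y ∈ P, B x y = 0

/-! ### Graded ideals and quotients -/

/-- A graded ideal: a subspace that contains the homogeneous components of its elements and is
stable under bracketing with `𝔤` on either side. -/
structure GradedIdeal (L : LieSuperalgebra K V) where
  carrier : Submodule K V
  graded : ∀ x ∈ carrier, ∀ i : ZMod 2, L.proj i x ∈ carrier
  bracket_mem_left : ∀ x : V, ∀ y ∈ carrier, L.bracket x y ∈ carrier
  bracket_mem_right : ∀ x ∈ carrier, ∀ y : V, L.bracket x y ∈ carrier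

/-- The bracket of the quotient `𝔤 / I`, induced by that of `𝔤`. -/
def quotientBracket (L : LieSuperalgebra K V) (I : L.GradedIdeal) :
    (V ⧸ I.carrier) →ₗ[K] (V ⧸ I.carrier) →ₗ[K] (V ⧸ I.carrier) :=
  I.carrier.liftQ
    (LinearMap.mk₂ K
      (fun x => I.carrier.mapQ I.carrier (L.bracket x) (I.bracket_mem_left x))
      (fun x y z => by
        obtain ⟨z, rfl⟩ := I.carrier.mkQ_surjective z
        simp)
      (fun c x z => by
        obtain ⟨z, rfl⟩ := I.carrier.mkQ_surjective z
        simp)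
      (fun x y z => by simp)
      (fun c x z => by simp))
    (fun x hx => by
      rw [LinearMap.mem_ker]
      ext z
      simpa using I.bracket_mem_right x hx z)

@[simp]
theorem quotientBracket_mk (L : LieSuperalgebra K V) (I : L.GradedIdeal) (x y : V) :
    L.quotientBracket I (I.carrier.mkQ x) (I.carrier.mkQ y) = I.carrier.mkQ (L.bracket x y) :=
  rfl

/-- The quotient Lie superalgebra `𝔤 / I` by a graded ideal. -/
def quotient (L : LieSuperalgebra K V) (I : L.GradedIdeal) :
    LieSuperalgebra K (V ⧸ I.carrier) where
  grade i := (L.grade i).map I.carrier.mkQ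
  isCompl_grade := by
    refine ⟨?_, ?_⟩
    · rw [Submodule.disjoint_def]
      rintro _ ⟨x, hx, rfl⟩ ⟨y, hy, hxy⟩
      have h : y - x ∈ I.carrier := by
        rw [← Submodule.ker_mkQ I.carrier, LinearMap.mem_ker, map_sub, hxy, sub_self]
      have h0 := I.graded _ h 0
      rw [map_sub, L.proj_zero_of_mem hy, L.proj_of_mem hx, zero_sub, neg_mem_iff] at h0
      simpa using h0
    · rw [codisjoint_iff, ← Submodule.map_sup, L.isCompl_grade.sup_eq_top, Submodule.map_top,
        Submodule.range_mkQ]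
  bracket := L.quotientBracket I
  bracket_mem := by
    rintro i j _ _ ⟨x, hx, rfl⟩ ⟨y, hy, rfl⟩
    exact ⟨L.bracket x y, L.bracket_mem i j x y hx hy, rfl⟩
  bracket_skew := by
    rintro i j _ _ ⟨x, hx, rfl⟩ ⟨y, hy, rfl⟩
    rw [quotientBracket_mk, quotientBracket_mk, L.bracket_skew i j x y hx hy, map_neg, map_smul]
  jacobi := by
    rintro i j k _ _ _ ⟨x, hx, rfl⟩ ⟨y, hy, rfl⟩ ⟨z, hz, rfl⟩
    simp only [quotientBracket_mk]
    rw [L.jacobi i j k x y z hx hy hz, map_add, map_smul]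

/-- A graded ideal, seen as a Lie superalgebra with the restricted bracket and grading. -/
def GradedIdeal.toLieSuperalgebra {L : LieSuperalgebra K V} (I : L.GradedIdeal) :
    LieSuperalgebra K I.carrier where
  grade i := (L.grade i).comap I.carrier.subtype
  isCompl_grade := by
    refine ⟨?_, ?_⟩
    · rw [Submodule.disjoint_def]
      intro x h0 h1
      exact Subtype.ext (Submodule.disjoint_def.1 L.isCompl_grade.disjoint x.1 h0 h1)
    · rw [codisjoint_iff, eq_top_iff]
      intro x _
      rw [Submodule.mem_sup]
      exact ⟨⟨L.proj 0 x, I.graded x x.2 0⟩, L.proj_mem 0 x,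
        ⟨L.proj 1 x, I.graded x x.2 1⟩, L.proj_mem 1 x, Subtype.ext (L.proj_add_proj x.1)⟩
  bracket := LinearMap.mk₂ K
    (fun x y => ⟨L.bracket x y, I.bracket_mem_left x y y.2⟩)
    (fun x y z => Subtype.ext (by simp))
    (fun c x y => Subtype.ext (by simp))
    (fun x y z => Subtype.ext (by simp))
    (fun c x y => Subtype.ext (by simp))
  bracket_mem i j x y hx hy := L.bracket_mem i j x y hx hy
  bracket_skew i j x y hx hy := Subtype.ext (L.bracket_skew i j x y hx hy)
  jacobi i j k x y z hx hy hz := Subtype.ext (L.jacobi i j k x y z hx hy hz)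

/-! ### The dual space and the coadjoint representation -/

/-- The component of degree `i` of the dual space: the linear forms vanishing on the homogeneous
component of degree `i + 1`. -/
def dualGrade (L : LieSuperalgebra K V) (i : ZMod 2) : Submodule K (Module.Dual K V) :=
  (L.grade (i + 1)).dualAnnihilator

/-- The homogeneous component of degree `i` of a linear form. -/
noncomputable def dualProj (L : LieSuperalgebra K V) (i : ZMod 2) :
    Module.Dual K V →ₗ[K] Module.Dual K V :=
  (L.proj i).dualMap

theorem mem_dualGrade (L : LieSuperalgebra K V) {i : ZMod 2} {F : Module.Dual K V} :
    F ∈ L.dualGrade i ↔ ∀ x ∈ L.grade (i + 1), F x = 0 :=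
  Submodule.mem_dualAnnihilator F

theorem dualProj_apply (L : LieSuperalgebra K V) (i : ZMod 2) (F : Module.Dual K V) (x : V) :
    L.dualProj i F x = F (L.proj i x) := rfl

theorem dualProj_mem (L : LieSuperalgebra K V) (i : ZMod 2) (F : Module.Dual K V) :
    L.dualProj i F ∈ L.dualGrade i := by
  rw [mem_dualGrade]
  intro x hx
  rw [dualProj_apply, L.proj_of_mem_add_one hx, map_zero]

theorem dualProj_add_dualProj (L : LieSuperalgebra K V) (F : Module.Dual K V) :
    L.dualProj 0 F + L.dualProj 1 F = F := by
  ext x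
  rw [LinearMap.add_apply, dualProj_apply, dualProj_apply, ← map_add, L.proj_add_proj]

theorem dualProj_zero_of_mem (L : LieSuperalgebra K V) {F : Module.Dual K V}
    (hF : F ∈ L.dualGrade 1) : L.dualProj 0 F = 0 := by
  ext x
  exact (L.mem_dualGrade.1 hF) _ (by rw [zmodTwo_one_add_one]; exact L.proj_mem 0 x)

theorem dualProj_one_of_mem (L : LieSuperalgebra K V) {F : Module.Dual K V}
    (hF : F ∈ L.dualGrade 0) : L.dualProj 1 F = 0 := by
  ext x
  exact (L.mem_dualGrade.1 hF) _ (by rw [zero_add]; exact L.proj_mem 1 x)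

theorem dualProj_of_mem (L : LieSuperalgebra K V) {i : ZMod 2} {F : Module.Dual K V}
    (hF : F ∈ L.dualGrade i) : L.dualProj i F = F := by
  rcases zmodTwo_cases i with rfl | rfl
  · simpa [L.dualProj_one_of_mem hF] using L.dualProj_add_dualProj F
  · simpa [L.dualProj_zero_of_mem hF] using L.dualProj_add_dualProj F

theorem isCompl_dualGrade (L : LieSuperalgebra K V) :
    IsCompl (L.dualGrade 0) (L.dualGrade 1) := by
  refine ⟨?_, ?_⟩
  · rw [Submodule.disjoint_def]
    intro F h0 h1
    rw [← L.dualProj_of_mem h0, L.dualProj_zero_of_mem h1]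
  · rw [codisjoint_iff, eq_top_iff]
    intro F _
    rw [Submodule.mem_sup]
    exact ⟨_, L.dualProj_mem 0 F, _, L.dualProj_mem 1 F, L.dualProj_add_dualProj F⟩

/-- The coadjoint representation `π`: on homogeneous `X` of degree `i` and `F` of degree `f` it is
`(π(X)F)(Y) = -(-1)^{if} F([X, Y])`, extended bilinearly through homogeneous components. -/
noncomputable def coadjoint (L : LieSuperalgebra K V) :
    V →ₗ[K] Module.Dual K V →ₗ[K] Module.Dual K V :=
  LinearMap.mk₂ K
    (fun X F => -∑ i : ZMod 2, ∑ f : ZMod 2,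
      superSign K i f • (L.dualProj f F ∘ₗ L.bracket (L.proj i X)))
    (fun X Y F => by
      ext Z
      simp only [zmodTwo_sum, map_add, LinearMap.comp_apply, LinearMap.neg_apply,
        LinearMap.add_apply, LinearMap.smul_apply, smul_eq_mul]
      ring)
    (fun c X F => by
      ext Z
      simp only [zmodTwo_sum, map_smul, LinearMap.comp_apply, LinearMap.neg_apply,
        LinearMap.add_apply, LinearMap.smul_apply, smul_eq_mul]
      ring)
    (fun X F G => by
      ext Z
      simp only [zmodTwo_sum, map_add, LinearMap.comp_apply, LinearMap.neg_apply,
        LinearMap.add_apply, LinearMap.smul_apply, smul_eq_mul]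
      ring)
    (fun c X F => by
      ext Z
      simp only [zmodTwo_sum, map_smul, LinearMap.comp_apply, LinearMap.neg_apply,
        LinearMap.add_apply, LinearMap.smul_apply, smul_eq_mul]
      ring)

theorem coadjoint_apply_of_mem (L : LieSuperalgebra K V) {i f : ZMod 2} {X : V}
    {F : Module.Dual K V} (hX : X ∈ L.grade i) (hF : F ∈ L.dualGrade f) (Y : V) :
    L.coadjoint X F Y = -(superSign K i f * F (L.bracket X Y)) := by
  simp only [coadjoint, LinearMap.mk₂_apply, zmodTwo_sum]
  rcases zmodTwo_cases i with rfl | rfl <;> rcases zmodTwo_cases f with rfl | rfl <;>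
    simp [L.proj_of_mem hX, L.dualProj_of_mem hF, L.proj_zero_of_mem, L.proj_one_of_mem,
      L.dualProj_zero_of_mem, L.dualProj_one_of_mem, hX, hF]

theorem coadjoint_mem (L : LieSuperalgebra K V) {i f : ZMod 2} {X : V} {F : Module.Dual K V}
    (hX : X ∈ L.grade i) (hF : F ∈ L.dualGrade f) : L.coadjoint X F ∈ L.dualGrade (i + f) := by
  rw [mem_dualGrade]
  intro Y hY
  rw [L.coadjoint_apply_of_mem hX hF, (L.mem_dualGrade.1 hF), mul_zero, neg_zero]
  have h := L.bracket_mem _ _ X Y hX hY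
  have e : i + (i + f + 1) = f + 1 := by
    have aux : ∀ a b : ZMod 2, a + (a + b + 1) = b + 1 := by decide
    exact aux i f
  rwa [e] at h

theorem coadjoint_bracket (L : LieSuperalgebra K V) {i j f : ZMod 2} {X Y : V}
    {F : Module.Dual K V} (hX : X ∈ L.grade i) (hY : Y ∈ L.grade j) (hF : F ∈ L.dualGrade f) :
    L.coadjoint (L.bracket X Y) F =
      L.coadjoint X (L.coadjoint Y F) - superSign K i j • L.coadjoint Y (L.coadjoint X F) := by
  have hJ : ∀ Z : V, L.bracket (L.bracket X Y) Z =
      L.bracket X (L.bracket Y Z) - superSign K i j • L.bracket Y (L.bracket X Z) := by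
    intro Z
    rw [← L.proj_add_proj Z]
    simp only [map_add]
    rw [L.jacobi i j 0 X Y _ hX hY (L.proj_mem 0 Z), L.jacobi i j 1 X Y _ hX hY (L.proj_mem 1 Z)]
    module
  ext Z
  rw [LinearMap.sub_apply, LinearMap.smul_apply,
    L.coadjoint_apply_of_mem (L.bracket_mem i j X Y hX hY) hF,
    L.coadjoint_apply_of_mem hX (L.coadjoint_mem hY hF),
    L.coadjoint_apply_of_mem hY (L.coadjoint_mem hX hF),
    L.coadjoint_apply_of_mem hX hF, L.coadjoint_apply_of_mem hY hF, hJ, map_sub, map_smul]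
  rcases zmodTwo_cases i with rfl | rfl <;> rcases zmodTwo_cases j with rfl | rfl <;>
    rcases zmodTwo_cases f with rfl | rfl <;>
    simp [superSign_zero_left, superSign_zero_right, superSign_one_one, zmodTwo_one_add_one] <;>
    ring

/-! ### Supercyclic cocycles and `T*`-extensions -/

/-- An even `2`-cocycle `ω` of `𝔤` with values in the coadjoint module `𝔤*` that is moreover
supercyclic. -/
structure SupercyclicCocycle (L : LieSuperalgebra K V) where
  toMap : V →ₗ[K] V →ₗ[K] Module.Dual K V
  even : ∀ (i j : ZMod 2) (X Y : V), X ∈ L.grade i → Y ∈ L.grade j →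
    toMap X Y ∈ L.dualGrade (i + j)
  skew : ∀ (i j : ZMod 2) (X Y : V), X ∈ L.grade i → Y ∈ L.grade j →
    toMap X Y = -(superSign K i j • toMap Y X)
  cocycle : ∀ (i j k : ZMod 2) (X Y Z : V), X ∈ L.grade i → Y ∈ L.grade j → Z ∈ L.grade k →
    toMap X (L.bracket Y Z) + superSign K i (j + k) • toMap Y (L.bracket Z X)
      + superSign K k (i + j) • toMap Z (L.bracket X Y)
      + L.coadjoint X (toMap Y Z) + superSign K i (j + k) • L.coadjoint Y (toMap Z X)
      + superSign K k (i + j) • L.coadjoint Z (toMap X Y) = 0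
  supercyclic : ∀ (i j k : ZMod 2) (X Y Z : V),
    X ∈ L.grade i → Y ∈ L.grade j → Z ∈ L.grade k →
    toMap X Y Z = superSign K i (j + k) * toMap Y Z X

/-- The bracket of the `T*`-extension on `𝔤 ⊕ 𝔤*`: for homogeneous `X + F` of degree `i` and
`Y + H` of degree `j` it is `[X, Y] + ω(X, Y) + π(X)H - (-1)^{ij} π(Y)F`, extended bilinearly
through homogeneous components. -/
noncomputable def tStarBracket (L : LieSuperalgebra K V)
    (ω : V →ₗ[K] V →ₗ[K] Module.Dual K V) :
    (V × Module.Dual K V) →ₗ[K] (V × Module.Dual K V) →ₗ[K] (V × Module.Dual K V) :=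
  LinearMap.mk₂ K
    (fun a b => (L.bracket a.1 b.1,
      ω a.1 b.1 + L.coadjoint a.1 b.2
        - ∑ i : ZMod 2, ∑ j : ZMod 2,
            superSign K i j • L.coadjoint (L.proj j b.1) (L.dualProj i a.2)))
    (fun a a' b => by
      refine Prod.ext ?_ ?_
      · simp
      · simp only [zmodTwo_sum, Prod.fst_add, Prod.snd_add, map_add, LinearMap.add_apply]
        module)
    (fun c a b => by
      refine Prod.ext ?_ ?_
      · simp
      · simp only [zmodTwo_sum, Prod.smul_fst, Prod.smul_snd, map_smul, LinearMap.smul_apply]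
        module)
    (fun a b b' => by
      refine Prod.ext ?_ ?_
      · simp
      · simp only [zmodTwo_sum, Prod.fst_add, Prod.snd_add, map_add, LinearMap.add_apply]
        module)
    (fun c a b => by
      refine Prod.ext ?_ ?_
      · simp
      · simp only [zmodTwo_sum, Prod.smul_fst, Prod.smul_snd, map_smul, LinearMap.smul_apply]
        module)

theorem tStarBracket_apply_of_mem (L : LieSuperalgebra K V)
    (ω : V →ₗ[K] V →ₗ[K] Module.Dual K V) {i j : ZMod 2} {a b : V × Module.Dual K V}
    (ha : a.2 ∈ L.dualGrade i) (hb : b.1 ∈ L.grade j) :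
    L.tStarBracket ω a b = (L.bracket a.1 b.1,
      ω a.1 b.1 + L.coadjoint a.1 b.2 - superSign K i j • L.coadjoint b.1 a.2) := by
  simp only [tStarBracket, LinearMap.mk₂_apply, zmodTwo_sum]
  rcases zmodTwo_cases i with rfl | rfl <;> rcases zmodTwo_cases j with rfl | rfl <;>
    simp [L.proj_of_mem hb, L.dualProj_of_mem ha, L.proj_zero_of_mem, L.proj_one_of_mem,
      L.dualProj_zero_of_mem, L.dualProj_one_of_mem, ha, hb]

/-- The form of the `T*`-extension on `𝔤 ⊕ 𝔤*`: for homogeneous `X + F` of degree `i` and `Y + H`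
of degree `j` it is `F(Y) + (-1)^{ij} H(X)`, extended bilinearly through homogeneous
components. -/
noncomputable def tStarForm (L : LieSuperalgebra K V) :
    LinearMap.BilinForm K (V × Module.Dual K V) :=
  LinearMap.mk₂ K
    (fun a b => a.2 b.1 +
      ∑ i : ZMod 2, ∑ j : ZMod 2, superSign K i j * L.dualProj j b.2 (L.proj i a.1))
    (fun a a' b => by
      simp only [zmodTwo_sum, Prod.fst_add, Prod.snd_add, map_add, LinearMap.add_apply]
      ring)
    (fun c a b => by
      simp only [zmodTwo_sum, Prod.smul_fst, Prod.smul_snd, map_smul, LinearMap.smul_apply,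
        smul_eq_mul]
      ring)
    (fun a b b' => by
      simp only [zmodTwo_sum, Prod.fst_add, Prod.snd_add, map_add, LinearMap.add_apply]
      ring)
    (fun c a b => by
      simp only [zmodTwo_sum, Prod.smul_fst, Prod.smul_snd, map_smul, LinearMap.smul_apply,
        smul_eq_mul]
      ring)

theorem tStarForm_apply_of_mem (L : LieSuperalgebra K V) {i j : ZMod 2}
    {a b : V × Module.Dual K V} (ha : a.1 ∈ L.grade i) (hb : b.2 ∈ L.dualGrade j) :
    L.tStarForm a b = a.2 b.1 + superSign K i j * b.2 a.1 := by
  simp only [tStarForm, LinearMap.mk₂_apply, zmodTwo_sum]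
  rcases zmodTwo_cases i with rfl | rfl <;> rcases zmodTwo_cases j with rfl | rfl <;>
    simp [L.proj_of_mem ha, L.dualProj_of_mem hb, L.proj_zero_of_mem, L.proj_one_of_mem,
      L.dualProj_zero_of_mem, L.dualProj_one_of_mem, ha, hb]

/-- The `T*`-extension `T*_ω 𝔤` of a Lie superalgebra `𝔤` by a supercyclic even `2`-cocycle `ω`,
as a Lie superalgebra on `𝔤 ⊕ 𝔤*`. Its invariant scalar product is `L.tStarForm`. -/
noncomputable def tStar (L : LieSuperalgebra K V) (ω : L.SupercyclicCocycle) :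
    LieSuperalgebra K (V × Module.Dual K V) where
  grade i := (L.grade i).prod (L.dualGrade i)
  isCompl_grade := by
    refine ⟨?_, ?_⟩
    · rw [Submodule.disjoint_def]
      rintro ⟨x, F⟩ ⟨hx0, hF0⟩ ⟨hx1, hF1⟩
      exact Prod.ext (Submodule.disjoint_def.1 L.isCompl_grade.disjoint x hx0 hx1)
        (Submodule.disjoint_def.1 L.isCompl_dualGrade.disjoint F hF0 hF1)
    · rw [codisjoint_iff, eq_top_iff]
      rintro ⟨x, F⟩ _
      rw [Submodule.mem_sup]
      exact ⟨(L.proj 0 x, L.dualProj 0 F), ⟨L.proj_mem 0 x, L.dualProj_mem 0 F⟩,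
        (L.proj 1 x, L.dualProj 1 F), ⟨L.proj_mem 1 x, L.dualProj_mem 1 F⟩,
        Prod.ext (L.proj_add_proj x) (L.dualProj_add_dualProj F)⟩
  bracket := L.tStarBracket ω.toMap
  bracket_mem := by
    rintro i j ⟨X, F⟩ ⟨Y, H⟩ ⟨hX, hF⟩ ⟨hY, hH⟩
    rw [L.tStarBracket_apply_of_mem ω.toMap hF hY]
    refine ⟨L.bracket_mem i j X Y hX hY, ?_⟩
    refine Submodule.sub_mem _ (Submodule.add_mem _ (ω.even i j X Y hX hY)
      (L.coadjoint_mem hX hH)) (Submodule.smul_mem _ _ ?_)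
    rw [add_comm i j]
    exact L.coadjoint_mem hY hF
  bracket_skew := by
    rintro i j ⟨X, F⟩ ⟨Y, H⟩ ⟨hX, hF⟩ ⟨hY, hH⟩
    rw [L.tStarBracket_apply_of_mem ω.toMap hF hY, L.tStarBracket_apply_of_mem ω.toMap hH hX]
    refine Prod.ext (L.bracket_skew i j X Y hX hY) ?_
    simp only [Prod.snd_neg, Prod.smul_snd]
    rw [ω.skew i j X Y hX hY]
    rcases zmodTwo_cases i with rfl | rfl <;> rcases zmodTwo_cases j with rfl | rfl <;>
      simp only [superSign_zero_left, superSign_zero_right, superSign_one_one] <;> module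
  jacobi := by
    rintro i j k ⟨X, F⟩ ⟨Y, H⟩ ⟨Z, G⟩ ⟨hX, hF⟩ ⟨hY, hH⟩ ⟨hZ, hG⟩
    simp only at hX hY hZ hF hH hG
    have hm : ∀ {i j : ZMod 2} {X Y : V} {F H : Module.Dual K V}, X ∈ L.grade i →
        Y ∈ L.grade j → F ∈ L.dualGrade i → H ∈ L.dualGrade j →
        ω.toMap X Y + L.coadjoint X H - superSign K i j • L.coadjoint Y F
          ∈ L.dualGrade (i + j) := by
      intro i j X Y F H hX hY hF hH
      refine Submodule.sub_mem _ (Submodule.add_mem _ (ω.even i j X Y hX hY)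
        (L.coadjoint_mem hX hH)) (Submodule.smul_mem _ _ ?_)
      rw [add_comm i j]
      exact L.coadjoint_mem hY hF
    have hc := ω.cocycle i j k X Y Z hX hY hZ
    rw [L.bracket_skew k i Z X hZ hX, ω.skew k i Z X hZ hX,
      ω.skew k (i + j) Z _ hZ (L.bracket_mem i j X Y hX hY)] at hc
    rw [L.tStarBracket_apply_of_mem ω.toMap (a := (Y, H)) (b := (Z, G)) hH hZ,
      L.tStarBracket_apply_of_mem ω.toMap (a := (X, F)) (b := (Y, H)) hF hY,
      L.tStarBracket_apply_of_mem ω.toMap (a := (X, F)) (b := (Z, G)) hF hZ,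
      L.tStarBracket_apply_of_mem ω.toMap (i := i) (j := j + k) hF
        (L.bracket_mem j k Y Z hY hZ),
      L.tStarBracket_apply_of_mem ω.toMap (i := i + j) (j := k) (hm hX hY hF hH) hZ,
      L.tStarBracket_apply_of_mem ω.toMap (i := j) (j := i + k) hH
        (L.bracket_mem i k X Z hX hZ)]
    refine Prod.ext (L.jacobi i j k X Y Z hX hY hZ) ?_
    simp only [Prod.snd_add, Prod.smul_snd]
    rw [L.coadjoint_bracket hX hY hG, L.coadjoint_bracket hX hZ hH, L.coadjoint_bracket hY hZ hF]
    simp only [map_add, map_sub, map_smul, map_neg] at hc ⊢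
    rw [← sub_eq_zero, ← hc]
    rcases zmodTwo_cases i with rfl | rfl <;> rcases zmodTwo_cases j with rfl | rfl <;>
      rcases zmodTwo_cases k with rfl | rfl <;>
      simp only [superSign_zero_left, superSign_zero_right, superSign_one_one, add_zero, zero_add,
        zmodTwo_one_add_one] <;> module

end LieSuperalgebra

/-!
# Nilpotent and solvable quadratic Lie superalgebras as `T*`-extensions

**Invariant lines.** Under either hypothesis, every nonzero quotient `P / I` of graded ideals
contains a homogeneous line invariant under the adjoint action (`HasInvariantLines`). In the
nilpotent case a line killed by the action is found in the last nonzero step of the filtration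
induced by the descending central series. In the solvable case, the classical Lie theorem for the
even part yields a vector of `P / I` killed by `[𝔤₀, 𝔤₀]`, and a second use of it, on the odd part
`𝔤₁`, allows the odd elements to be treated one at a time: if `y` is an eigenvector of `𝔤₀` in `𝔤₁`
modulo a stable subspace `S`, and `w` is killed by `[𝔤₀, 𝔤₀]` and `S`, then so is `[y, w]`, which
moreover is killed by `y` because `2 [y, [y, w]] = [[y, y], w]` and
`[y, y] ∈ [𝔤₁, 𝔤₁] ⊆ [𝔤₀, 𝔤₀]`. Hence some vector is killed by `[𝔤₀, 𝔤₀]` and all of `𝔤₁`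
(`exists_odd_annihilated`), and Lie's theorem on the space of vectors killed by `𝔤₁` gives the line.

**Isotropic ideals.** Let `I` be a totally isotropic graded ideal. An anisotropic invariant line
`K w` in `I^⊥ / I` is even and the action on it is trivial, since `B([x, w], w) = B(x, [w, w]) = 0`.
If `dim I^⊥ / I ≥ 2` and `w` is anisotropic, there is a second invariant line in `w^⊥`; two
anisotropic ones contain an isotropic combination `w + c v`, again killed by the action. So `I` can
be enlarged until `dim I = ⌊dim 𝔤 / 2⌋` (`exists_isotropic_ideal`).

**`T*`-extensions.** Let `p` be a morphism from a quadratic Lie superalgebra onto `M` with totally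
isotropic kernel of half the dimension. It has a graded section `s` with totally isotropic image,
`ω(X, Y)(Z) = B([s X, s Y], s Z)` is a supercyclic cocycle of `M`, and `v ↦ (p v, B(v, s ·))` is an
isometry onto `T*_ω M` (`IsLagrangianProj.isIsometric_tStar`). In even dimension this applies to
`𝔤 → 𝔤 / I`. In odd dimension `I^⊥ = I + K w` with `w` even and anisotropic, and it applies to the
orthogonal sum of `𝔤` with a central line `K e`, `B(e, e) = -B(w, w)`, mapped to `𝔤 / I` by
`v + t e ↦ v - t w`; the image of `𝔤` is the ideal of codimension one.
-/

namespace LieSuperalgebra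

variable {K V W : Type*} [Field K] [AddCommGroup V] [Module K V] [AddCommGroup W] [Module K W]

/-! ### Homogeneous components and graded ideals -/

theorem zmodTwo_eq_or_eq_add_one (i j : ZMod 2) : i = j ∨ i = j + 1 := by
  revert i j; decide

theorem homogeneous_induction (L : LieSuperalgebra K V) {p : V → Prop}
    (hadd : ∀ x y, p x → p y → p (x + y)) (hom : ∀ i, ∀ x ∈ L.grade i, p x) (x : V) : p x := by
  rw [← L.proj_add_proj x]
  exact hadd _ _ (hom 0 _ (L.proj_mem 0 x)) (hom 1 _ (L.proj_mem 1 x))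

theorem map_proj (L : LieSuperalgebra K V) (M : LieSuperalgebra K W) (f : V →ₗ[K] W)
    (hf : ∀ i, ∀ x ∈ L.grade i, f x ∈ M.grade i) (i : ZMod 2) (x : V) :
    f (L.proj i x) = M.proj i (f x) := by
  induction x using L.homogeneous_induction with
  | hadd x y hx hy => simp only [map_add, hx, hy]
  | hom j x hx =>
    obtain rfl | rfl := zmodTwo_eq_or_eq_add_one j i
    · rw [L.proj_of_mem hx, M.proj_of_mem (hf _ x hx)]
    · rw [L.proj_of_mem_add_one hx, M.proj_of_mem_add_one (hf _ x hx), map_zero]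

theorem bracket_proj (L : LieSuperalgebra K V) {j : ZMod 2} {x : V} (hx : x ∈ L.grade j)
    (i : ZMod 2) (y : V) : L.bracket x (L.proj i y) = L.proj (j + i) (L.bracket x y) := by
  induction y using L.homogeneous_induction with
  | hadd y z hy hz => simp only [map_add, hy, hz]
  | hom k y hy =>
    have h := L.bracket_mem j k x y hx hy
    obtain rfl | rfl := zmodTwo_eq_or_eq_add_one k i
    · rw [L.proj_of_mem hy, L.proj_of_mem h]
    · rw [L.proj_of_mem_add_one hy, map_zero, L.proj_of_mem_add_one (by rwa [add_assoc])]

/-- The super Jacobi identity, for a last argument that need not be homogeneous. -/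
theorem bracket_bracket (L : LieSuperalgebra K V) {i j : ZMod 2} {x y : V} (hx : x ∈ L.grade i)
    (hy : y ∈ L.grade j) (z : V) : L.bracket x (L.bracket y z) =
      L.bracket (L.bracket x y) z + superSign K i j • L.bracket y (L.bracket x z) := by
  induction z using L.homogeneous_induction with
  | hadd z w hz hw => simp only [map_add, hz, hw, smul_add]; abel
  | hom k z hz => exact L.jacobi i j k x y z hx hy hz

theorem bracket_mem_swap (L : LieSuperalgebra K V) (P : Submodule K V) {i j : ZMod 2} {x y : V}
    (hx : x ∈ L.grade i) (hy : y ∈ L.grade j) (h : L.bracket x y ∈ P) : L.bracket y x ∈ P := by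
  rw [L.bracket_skew j i y x hy hx]
  exact P.neg_mem (P.smul_mem _ h)

theorem exists_proj_notMem (L : LieSuperalgebra K V) {P : Submodule K V} {x : V} (hx : x ∉ P) :
    ∃ i, L.proj i x ∉ P := by
  by_contra! h
  exact hx (L.proj_add_proj x ▸ P.add_mem (h 0) (h 1))

theorem bracket_mem_bracketSpan (L : LieSuperalgebra K V) {P Q : Submodule K V} {x y : V}
    (hx : x ∈ P) (hy : y ∈ Q) : L.bracket x y ∈ L.bracketSpan P Q :=
  Submodule.apply_mem_map₂ _ hx hy

/-- A graded subspace that absorbs brackets with homogeneous elements on the right is a graded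
ideal. -/
def GradedIdeal.ofRight (L : LieSuperalgebra K V) (P : Submodule K V)
    (hg : ∀ x ∈ P, ∀ i : ZMod 2, L.proj i x ∈ P)
    (hr : ∀ x ∈ P, ∀ j, ∀ y ∈ L.grade j, L.bracket x y ∈ P) : L.GradedIdeal where
  carrier := P
  graded := hg
  bracket_mem_left y x hx := by
    induction y using L.homogeneous_induction with
    | hadd y z hy hz => simpa using P.add_mem hy hz
    | hom j y hy =>
      rw [← L.proj_add_proj x, map_add]
      exact P.add_mem
        (L.bracket_mem_swap P (L.proj_mem 0 x) hy (hr _ (hg x hx 0) j y hy))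
        (L.bracket_mem_swap P (L.proj_mem 1 x) hy (hr _ (hg x hx 1) j y hy))
  bracket_mem_right x hx y := by
    induction y using L.homogeneous_induction with
    | hadd y z hy hz => simpa using P.add_mem hy hz
    | hom j y hy => exact hr x hx j y hy

/-- The graded ideal `I + K w`, for a homogeneous `w` that spans an invariant line modulo `I`. -/
def GradedIdeal.addLine {L : LieSuperalgebra K V} (I : L.GradedIdeal) {i : ZMod 2} {w : V}
    (hw : w ∈ L.grade i) (h : ∀ x, ∃ c : K, L.bracket x w - c • w ∈ I.carrier) :
    L.GradedIdeal :=
  GradedIdeal.ofRight L (I.carrier ⊔ Submodule.span K {w})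
    (by
      intro x hx j
      obtain ⟨y, hy, z, hz, rfl⟩ := Submodule.mem_sup.1 hx
      obtain ⟨c, rfl⟩ := Submodule.mem_span_singleton.1 hz
      rw [map_add, map_smul]
      refine Submodule.add_mem_sup (I.graded y hy j) (Submodule.smul_mem _ c ?_)
      obtain rfl | rfl := zmodTwo_eq_or_eq_add_one i j
      · rw [L.proj_of_mem hw]; exact Submodule.mem_span_singleton_self w
      · rw [L.proj_of_mem_add_one hw]; exact Submodule.zero_mem _)
    (by
      intro x hx j u hu
      obtain ⟨y, hy, z, hz, rfl⟩ := Submodule.mem_sup.1 hx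
      obtain ⟨c, rfl⟩ := Submodule.mem_span_singleton.1 hz
      rw [map_add, LinearMap.add_apply, map_smul, LinearMap.smul_apply]
      refine Submodule.add_mem _ (Submodule.mem_sup_left (I.bracket_mem_right y hy u))
        (Submodule.smul_mem _ c (L.bracket_mem_swap _ hu hw ?_))
      obtain ⟨d, hd⟩ := h u
      rw [← sub_add_cancel (L.bracket u w) (d • w)]
      exact Submodule.add_mem_sup hd
        (Submodule.smul_mem _ d (Submodule.mem_span_singleton_self w)))

/-! ### Lie's theorem for the even part -/

section EvenPart

variable [CharZero K] (L : LieSuperalgebra K V)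

/-- The even part of a Lie superalgebra is a Lie algebra. -/
instance evenLieRing : LieRing (L.grade 0) where
  bracket x y := ⟨L.bracket x y, by simpa using L.bracket_mem 0 0 x y x.2 y.2⟩
  add_lie x y z := Subtype.ext (by simp)
  lie_add x y z := Subtype.ext (by simp)
  lie_self x := Subtype.ext (by
    have h := L.bracket_skew 0 0 x x x.2 x.2
    rw [superSign_zero_left, one_smul, eq_neg_iff_add_eq_zero, ← two_smul K] at h
    exact (smul_eq_zero.1 h).resolve_left two_ne_zero)
  leibniz_lie x y z := Subtype.ext (by
    simpa [superSign_zero_left] using L.jacobi 0 0 0 x y z x.2 y.2 z.2)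

instance evenLieAlgebra : LieAlgebra K (L.grade 0) where
  lie_smul c x y := Subtype.ext (map_smul (L.bracket x) c (y : V))

/-- The whole Lie superalgebra is a module over its even part. -/
instance evenLieRingModule : LieRingModule (L.grade 0) V where
  bracket x v := L.bracket x v
  add_lie x y v := by simp
  lie_add x v w := by simp
  leibniz_lie x y v := by
    have h := L.bracket_bracket x.2 y.2 v
    rwa [superSign_zero_left, one_smul] at h

instance evenLieModule : LieModule K (L.grade 0) V where
  smul_lie c x v := by
    change L.bracket (c • (x : V)) v = c • L.bracket x v
    rw [map_smul, LinearMap.smul_apply]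
  lie_smul c x v := map_smul (L.bracket x) c v

theorem isSolvable_even (h : L.IsSolvable) : LieAlgebra.IsSolvable (L.grade 0) := by
  obtain ⟨n, hn⟩ := h
  have key : ∀ n, ∀ x ∈ LieAlgebra.derivedSeries K (L.grade 0) n, (x : V) ∈ L.derived n := by
    intro n
    induction n with
    | zero => exact fun x _ => Submodule.mem_top
    | succ n ih =>
      intro x hx
      rw [LieAlgebra.derivedSeries_def, LieAlgebra.derivedSeriesOfIdeal_succ,
        ← LieSubmodule.mem_toSubmodule, LieSubmodule.lieIdeal_oper_eq_linear_span'] at hx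
      induction hx using Submodule.span_induction with
      | mem x hx =>
        obtain ⟨y, hy, z, hz, rfl⟩ := hx
        exact L.bracket_mem_bracketSpan (ih y hy) (ih z hz)
      | zero => exact Submodule.zero_mem _
      | add x y _ _ hx hy => exact Submodule.add_mem _ hx hy
      | smul c x _ hx => exact Submodule.smul_mem _ c hx
  refine LieAlgebra.IsSolvable.mk (R := K) (k := n) ?_
  rw [eq_bot_iff]
  intro x hx
  have := key n x hx
  rw [hn, Submodule.mem_bot] at this
  exact (LieSubmodule.mem_bot x).2 (Subtype.ext this)

/-- Lie's theorem for the adjoint action of the even part of a solvable Lie superalgebra on a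
quotient `P / N ∩ P` of stable subspaces: there is a common eigenvector, and it is killed by the
derived algebra of the even part. -/
theorem exists_even_eigenvector [IsAlgClosed K] [FiniteDimensional K V] (h : L.IsSolvable)
    {N P : Submodule K V} (hN : ∀ x ∈ L.grade 0, ∀ v ∈ N, L.bracket x v ∈ N)
    (hP : ∀ x ∈ L.grade 0, ∀ v ∈ P, L.bracket x v ∈ P) (hPN : ¬ P ≤ N) :
    ∃ v ∈ P, v ∉ N ∧ (∀ x ∈ L.grade 0, ∃ c : K, L.bracket x v - c • v ∈ N) ∧
      ∀ x ∈ L.bracketSpan (L.grade 0) (L.grade 0), L.bracket x v ∈ N := by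
  have := L.isSolvable_even h
  let P' : LieSubmodule K (L.grade 0) V := { P with lie_mem := fun {x v} hv => hP x x.2 v hv }
  let N' : LieSubmodule K (L.grade 0) V := { N with lie_mem := fun {x v} hv => hN x x.2 v hv }
  let Q : LieSubmodule K (L.grade 0) P' := N'.comap P'.incl
  obtain ⟨u, hu, huN⟩ := Set.not_subset.1 hPN
  have hnt : Nontrivial (P' ⧸ Q) := by
    refine ⟨LieSubmodule.Quotient.mk (⟨u, hu⟩ : P'), 0, fun h0 => huN ?_⟩
    exact (LieSubmodule.Quotient.mk_eq_zero' (N := Q)).1 h0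
  obtain ⟨χ, hχ⟩ := LieModule.exists_nontrivial_weightSpace_of_isSolvable K (L.grade 0) (P' ⧸ Q)
  obtain ⟨⟨w, hw⟩, hw0⟩ := exists_ne (0 : LieModule.weightSpace (P' ⧸ Q) χ)
  obtain ⟨⟨v, hv⟩, rfl⟩ := LieSubmodule.Quotient.surjective_mk' Q w
  rw [LieModule.mem_weightSpace] at hw
  have hv' : ∀ x (hx : x ∈ L.grade 0), L.bracket x v - χ ⟨x, hx⟩ • v ∈ N := by
    intro x hx
    have h1 := sub_eq_zero.2 (hw ⟨x, hx⟩)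
    exact (LieSubmodule.Quotient.mk_eq_zero' (N := Q)
      (m := ⁅(⟨x, hx⟩ : L.grade 0), (⟨v, hv⟩ : P')⁆ - χ ⟨x, hx⟩ • (⟨v, hv⟩ : P'))).1 h1
  refine ⟨v, hv, fun hvN => hw0 ?_, fun x hx => ⟨_, hv' x hx⟩, fun x hx => ?_⟩
  · exact Subtype.ext ((LieSubmodule.Quotient.mk_eq_zero' (N := Q)).2 hvN)
  · have hle : L.bracketSpan (L.grade 0) (L.grade 0) ≤ N.comap (L.bracket.flip v) := by
      refine Submodule.map₂_le.2 fun x hx y hy => ?_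
      -- modulo `N` both `[x, [y, v]]` and `[y, [x, v]]` are `χ x * χ y` times `v`
      have e := L.bracket_bracket hx hy v
      rw [superSign_zero_left, one_smul] at e
      rw [Submodule.mem_comap, LinearMap.flip_apply, eq_sub_of_add_eq e.symm]
      have h1 := N.add_mem (hN x hx _ (hv' y hy)) (N.smul_mem (χ ⟨y, hy⟩) (hv' x hx))
      have h2 := N.add_mem (hN y hy _ (hv' x hx)) (N.smul_mem (χ ⟨x, hx⟩) (hv' y hy))
      convert N.sub_mem h1 h2 using 1
      simp only [map_sub, map_smul]
      module
    exact hle hx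

end EvenPart

/-! ### Invariant lines in subquotients of the adjoint representation -/

/-- Every nonzero quotient of graded ideals contains a homogeneous line that is invariant under
the adjoint action. -/
def HasInvariantLines (L : LieSuperalgebra K V) : Prop :=
  ∀ I P : L.GradedIdeal, ¬ P.carrier ≤ I.carrier →
    ∃ i, ∃ w ∈ L.grade i, w ∈ P.carrier ∧ w ∉ I.carrier ∧
      ∀ x, ∃ c : K, L.bracket x w - c • w ∈ I.carrier

theorem IsNilpotent.hasInvariantLines {L : LieSuperalgebra K V} (h : L.IsNilpotent) :
    L.HasInvariantLines := by
  intro I P hPI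
  obtain ⟨n, hn⟩ := h
  have hex : ∃ k, P.carrier ⊓ L.lowerCentral k ≤ I.carrier := ⟨n, by simp [hn]⟩
  -- the last nonzero term of the filtration of `P / I` by the descending central series
  obtain ⟨k, hk, hk'⟩ : ∃ k, ¬ P.carrier ⊓ L.lowerCentral k ≤ I.carrier ∧
      P.carrier ⊓ L.lowerCentral (k + 1) ≤ I.carrier := by
    by_contra! hc
    have : ∀ k, ¬ P.carrier ⊓ L.lowerCentral k ≤ I.carrier := by
      intro k
      induction k with
      | zero => simpa [lowerCentral] using hPI
      | succ k ih => exact hc k ih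
    exact hex.elim fun k hk => this k hk
  obtain ⟨w, ⟨hwP, hwk⟩, hwI⟩ := Set.not_subset.1 hk
  obtain ⟨i, hi⟩ := L.exists_proj_notMem hwI
  refine ⟨i, _, L.proj_mem i w, P.graded w hwP i, hi, fun x => ⟨0, ?_⟩⟩
  rw [zero_smul, sub_zero]
  induction x using L.homogeneous_induction with
  | hadd x y hx hy => simpa using I.carrier.add_mem hx hy
  | hom j x hx =>
    rw [L.bracket_proj hx]
    exact I.graded _ (hk' ⟨P.bracket_mem_left x w hwP,
      L.bracket_mem_bracketSpan Submodule.mem_top hwk⟩) _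

/-- If `[𝔤₁, 𝔤₁] ⊆ [𝔤₀, 𝔤₀]`, some vector of `P` outside `I` is sent into `I` by the whole odd
part. -/
theorem exists_odd_annihilated [IsAlgClosed K] [CharZero K] [FiniteDimensional K V]
    (L : LieSuperalgebra K V) (h : L.IsSolvable)
    (h1 : L.bracketSpan (L.grade 1) (L.grade 1) ≤ L.bracketSpan (L.grade 0) (L.grade 0))
    (I P : L.GradedIdeal) (hPI : ¬ P.carrier ≤ I.carrier) :
    ∃ w ∈ P.carrier, w ∉ I.carrier ∧ ∀ y ∈ L.grade 1, L.bracket y w ∈ I.carrier := by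
  let 𝒮 : Set (Submodule K V) := {S | S ≤ L.grade 1 ∧
    (∀ x ∈ L.grade 0, ∀ v ∈ S, L.bracket x v ∈ S) ∧
    ∃ w ∈ P.carrier, w ∉ I.carrier ∧
      (∀ x ∈ L.bracketSpan (L.grade 0) (L.grade 0), L.bracket x w ∈ I.carrier) ∧
      ∀ y ∈ S, L.bracket y w ∈ I.carrier}
  have hne : 𝒮.Nonempty := by
    obtain ⟨w, hw, hwI, -, hw0⟩ := L.exists_even_eigenvector h
      (fun x _ => I.bracket_mem_left x) (fun x _ => P.bracket_mem_left x) hPI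
    refine ⟨⊥, bot_le, fun x _ v hv => ?_, w, hw, hwI, hw0, fun y hy => ?_⟩
    · rw [(Submodule.mem_bot K).1 hv, map_zero]; exact Submodule.zero_mem _
    · rw [(Submodule.mem_bot K).1 hy, map_zero]; exact Submodule.zero_mem _
  obtain ⟨S, ⟨hS1, hS0, w, hwP, hwI, hw0, hwS⟩, hmax⟩ :=
    (wellFounded_gt : WellFounded ((· > ·) : Submodule K V → _ → Prop)).has_min 𝒮 hne
  suffices hS : L.grade 1 ≤ S from ⟨w, hwP, hwI, fun y hy => hwS y (hS hy)⟩
  by_contra hS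
  obtain ⟨y, hy, hyS, hyc, hy0⟩ := L.exists_even_eigenvector h hS0
    (fun x hx v hv => by simpa using L.bracket_mem 0 1 x v hx hv) hS
  -- `S + K y` contradicts maximality as soon as some vector is killed by `S`, `y` and `[𝔤₀, 𝔤₀]`
  have hadd : ∀ v ∈ P.carrier, v ∉ I.carrier →
      (∀ x ∈ L.bracketSpan (L.grade 0) (L.grade 0), L.bracket x v ∈ I.carrier) →
      (∀ u ∈ S, L.bracket u v ∈ I.carrier) → L.bracket y v ∉ I.carrier := by
    intro v hvP hvI hv0 hvS hyv
    refine hmax (S ⊔ Submodule.span K {y}) ⟨?_, ?_, v, hvP, hvI, hv0, ?_⟩ ?_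
    · exact sup_le hS1 ((Submodule.span_singleton_le_iff_mem _ _).2 hy)
    · intro x hx z hz
      obtain ⟨s, hs, t, ht, rfl⟩ := Submodule.mem_sup.1 hz
      obtain ⟨a, rfl⟩ := Submodule.mem_span_singleton.1 ht
      rw [map_add, map_smul]
      refine Submodule.add_mem _ (Submodule.mem_sup_left (hS0 x hx s hs))
        (Submodule.smul_mem _ a ?_)
      obtain ⟨c, hc⟩ := hyc x hx
      rw [← sub_add_cancel (L.bracket x y) (c • y)]
      exact Submodule.add_mem_sup hc
        (Submodule.smul_mem _ c (Submodule.mem_span_singleton_self y))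
    · intro z hz
      obtain ⟨s, hs, t, ht, rfl⟩ := Submodule.mem_sup.1 hz
      obtain ⟨a, rfl⟩ := Submodule.mem_span_singleton.1 ht
      rw [map_add, LinearMap.add_apply, map_smul, LinearMap.smul_apply]
      exact I.carrier.add_mem (hvS s hs) (I.carrier.smul_mem a hyv)
    · refine lt_of_le_of_ne le_sup_left fun e => hyS ?_
      rw [e]
      exact Submodule.mem_sup_right (Submodule.mem_span_singleton_self y)
  -- either `w` or `[y, w]` is such a vector
  refine hadd (L.bracket y w) (P.bracket_mem_left y w hwP) (hadd w hwP hwI hw0 hwS) ?_ ?_ ?_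
  · intro x hx
    have hx0 : x ∈ L.grade 0 := by
      refine (Submodule.map₂_le.2 fun a ha b hb => ?_ :
        L.bracketSpan (L.grade 0) (L.grade 0) ≤ L.grade 0) hx
      simpa using L.bracket_mem 0 0 a b ha hb
    rw [L.bracket_bracket hx0 hy]
    exact I.carrier.add_mem (hwS _ (hy0 x hx))
      (I.carrier.smul_mem _ (I.bracket_mem_left y _ (hw0 x hx)))
  · intro u hu
    rw [L.bracket_bracket (hS1 hu) hy]
    exact I.carrier.add_mem (hw0 _ (h1 (L.bracket_mem_bracketSpan (hS1 hu) hy)))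
      (I.carrier.smul_mem _ (I.bracket_mem_left y _ (hwS u hu)))
  · have e := L.bracket_bracket hy hy w
    rw [superSign_one_one, neg_one_smul, ← sub_eq_add_neg, eq_sub_iff_add_eq, ← two_smul K] at e
    have h2 := hw0 _ (h1 (L.bracket_mem_bracketSpan hy hy))
    rw [← e] at h2
    exact (Submodule.smul_mem_iff _ two_ne_zero).1 h2

theorem IsSolvable.hasInvariantLines [IsAlgClosed K] [CharZero K] [FiniteDimensional K V]
    {L : LieSuperalgebra K V} (h : L.IsSolvable)
    (h1 : L.bracketSpan (L.grade 1) (L.grade 1) ≤ L.bracketSpan (L.grade 0) (L.grade 0)) :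
    L.HasInvariantLines := by
  intro I P hPI
  obtain ⟨w, hwP, hwI, hw1⟩ := L.exists_odd_annihilated h h1 I P hPI
  obtain ⟨i, hi⟩ := L.exists_proj_notMem hwI
  -- vectors of `P` of degree `i` that the odd part sends into `I`
  let Q : Submodule K V := P.carrier ⊓ L.grade i ⊓
    ⨅ y : L.grade 1, I.carrier.comap (L.bracket y)
  have memQ : ∀ v, v ∈ Q ↔ (v ∈ P.carrier ∧ v ∈ L.grade i) ∧
      ∀ y ∈ L.grade 1, L.bracket y v ∈ I.carrier := by
    intro v
    simp [Q, Submodule.mem_iInf]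
  have hwQ : L.proj i w ∈ Q := by
    refine (memQ _).2 ⟨⟨P.graded w hwP i, L.proj_mem i w⟩, fun y hy => ?_⟩
    rw [L.bracket_proj hy]
    exact I.graded _ (hw1 y hy) _
  obtain ⟨v, hv, hvI, hvc, -⟩ := L.exists_even_eigenvector h (N := I.carrier) (P := Q)
    (fun x _ => I.bracket_mem_left x) (by
      intro x hx v hv
      obtain ⟨⟨hvP, hvi⟩, hv1⟩ := (memQ v).1 hv
      refine (memQ _).2 ⟨⟨P.bracket_mem_left x v hvP, by
        simpa using L.bracket_mem 0 i x v hx hvi⟩, fun y hy => ?_⟩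
      rw [L.bracket_bracket hy hx]
      exact I.carrier.add_mem (hv1 _ (by simpa using L.bracket_mem 1 0 y x hy hx))
        (I.carrier.smul_mem _ (I.bracket_mem_left x _ (hv1 y hy)))) (fun hle => hi (hle hwQ))
  obtain ⟨⟨hvP, hvi⟩, hv1⟩ := (memQ v).1 hv
  refine ⟨i, v, hvi, hvP, hvI, fun x => ?_⟩
  obtain ⟨c, hc⟩ := hvc _ (L.proj_mem 0 x)
  refine ⟨c, ?_⟩
  have e : L.bracket x v - c • v =
      (L.bracket (L.proj 0 x) v - c • v) + L.bracket (L.proj 1 x) v := by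
    conv_lhs => rw [← L.proj_add_proj x, map_add, LinearMap.add_apply]
    abel
  rw [e]
  exact I.carrier.add_mem hc (hv1 _ (L.proj_mem 1 x))

/-! ### Orthogonal subspaces -/

section Perp

/-- The left orthogonal `{x | B(x, P) = 0}` of a subspace `P`. -/
def leftPerp (B : LinearMap.BilinForm K V) (P : Submodule K V) : Submodule K V :=
  P.dualAnnihilator.comap B

variable {B : LinearMap.BilinForm K V}

theorem mem_leftPerp {P : Submodule K V} {x : V} :
    x ∈ leftPerp B P ↔ ∀ y ∈ P, B x y = 0 :=
  Submodule.mem_dualAnnihilator _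

theorem finrank_add_finrank_leftPerp [FiniteDimensional K V] (hB : B.Nondegenerate)
    (P : Submodule K V) :
    Module.finrank K P + Module.finrank K (leftPerp B P) = Module.finrank K V := by
  have e : leftPerp B P = P.dualAnnihilator.comap (LinearMap.BilinForm.toDual B hB).toLinearMap :=
    rfl
  rw [e, Submodule.comap_equiv_eq_map_symm, LinearEquiv.finrank_map_eq,
    Subspace.finrank_add_finrank_dualAnnihilator_eq]

theorem IsTotallyIsotropic.le_leftPerp {P : Submodule K V} (h : IsTotallyIsotropic B P) :
    P ≤ leftPerp B P := fun x hx => mem_leftPerp.2 (h x hx)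

theorem IsTotallyIsotropic.two_mul_finrank_le [FiniteDimensional K V] (hB : B.Nondegenerate)
    {P : Submodule K V} (h : IsTotallyIsotropic B P) :
    2 * Module.finrank K P ≤ Module.finrank K V := by
  have h1 := finrank_add_finrank_leftPerp hB P
  have h2 := Submodule.finrank_mono h.le_leftPerp
  omega

theorem IsTotallyIsotropic.maximal_of_finrank [FiniteDimensional K V] (hB : B.Nondegenerate)
    {P : Submodule K V} (h : IsTotallyIsotropic B P)
    (hP : Module.finrank K P = Module.finrank K V / 2) : Maximal (IsTotallyIsotropic B) P := by
  refine ⟨h, fun Q hQ hPQ => ?_⟩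
  have := hQ.two_mul_finrank_le hB
  exact (Submodule.eq_of_le_of_finrank_le hPQ (by omega)).ge

end Perp

section Invariant

variable {L : LieSuperalgebra K V} {B : LinearMap.BilinForm K V}

namespace IsInvariantScalarProduct

theorem apply_eq_zero (hB : L.IsInvariantScalarProduct B) {i j : ZMod 2} (hij : i = j + 1)
    {x y : V} (hx : x ∈ L.grade i) (hy : y ∈ L.grade j) : B x y = 0 := by
  subst hij
  rcases zmodTwo_cases j with rfl | rfl
  · rw [hB.supersymm _ _ x y hx hy, hB.even y hy x hx, mul_zero]
  · exact hB.even x hx y hy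

theorem apply_proj (hB : L.IsInvariantScalarProduct B) (i : ZMod 2) (x y : V) :
    B (L.proj i x) y = B x (L.proj i y) := by
  induction x using L.homogeneous_induction with
  | hadd x z hx hz => simp only [map_add, LinearMap.add_apply, hx, hz]
  | hom j x hx =>
    induction y using L.homogeneous_induction with
    | hadd y z hy hz => simp only [map_add, hy, hz]
    | hom k y hy =>
      obtain h | h := zmodTwo_eq_or_eq_add_one j i <;>
        obtain h' | h' := zmodTwo_eq_or_eq_add_one k i
      · rw [L.proj_of_mem (h ▸ hx), L.proj_of_mem (h' ▸ hy)]
      · rw [L.proj_of_mem (h ▸ hx), L.proj_of_mem_add_one (h' ▸ hy), map_zero,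
          hB.apply_eq_zero (by rw [h, h', add_assoc, zmodTwo_one_add_one, add_zero]) hx hy]
      · rw [L.proj_of_mem_add_one (h ▸ hx), L.proj_of_mem (h' ▸ hy), map_zero,
          hB.apply_eq_zero (by rw [h, h']) hx hy, LinearMap.zero_apply]
      · rw [L.proj_of_mem_add_one (h ▸ hx), L.proj_of_mem_add_one (h' ▸ hy), map_zero, map_zero,
          LinearMap.zero_apply]

/-- Orthogonality to a graded subspace does not depend on the side. -/
theorem apply_comm_of_graded (hB : L.IsInvariantScalarProduct B) {P : Submodule K V}
    (hP : ∀ x ∈ P, ∀ i : ZMod 2, L.proj i x ∈ P) {x : V} (h : ∀ y ∈ P, B x y = 0) :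
    ∀ y ∈ P, B y x = 0 := by
  have key : ∀ i : ZMod 2, ∀ y ∈ P, B (L.proj i y) x = 0 := by
    intro i y hy
    have e : B (L.proj i y) x = B (L.proj i y) (L.proj i x) := by
      rw [← hB.apply_proj, L.proj_of_mem (L.proj_mem i y)]
    rw [e, hB.supersymm i i _ _ (L.proj_mem i y) (L.proj_mem i x), hB.apply_proj,
      L.proj_of_mem (L.proj_mem i y), h _ (hP y hy i), mul_zero]
  intro y hy
  rw [← L.proj_add_proj y, map_add, LinearMap.add_apply, key 0 y hy, key 1 y hy, add_zero]

/-- The orthogonal of a graded ideal is a graded ideal. -/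
def perp (hB : L.IsInvariantScalarProduct B) (I : L.GradedIdeal) : L.GradedIdeal :=
  GradedIdeal.ofRight L (leftPerp B I.carrier)
    (fun x hx i => mem_leftPerp.2 fun y hy => by
      rw [hB.apply_proj]; exact mem_leftPerp.1 hx _ (I.graded y hy i))
    (fun x hx _ y _ => mem_leftPerp.2 fun z hz => by
      rw [hB.invariant]; exact mem_leftPerp.1 hx _ (I.bracket_mem_left y z hz))

/-! ### Totally isotropic ideals of maximal dimension -/

variable {I : L.GradedIdeal} {i : ZMod 2} {w : V}

theorem isTotallyIsotropic_addLine (hB : L.IsInvariantScalarProduct B)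
    (hI : IsTotallyIsotropic B I.carrier) (hw : w ∈ L.grade i)
    (h : ∀ x, ∃ c : K, L.bracket x w - c • w ∈ I.carrier)
    (hwI : w ∈ (hB.perp I).carrier) (hww : B w w = 0) :
    IsTotallyIsotropic B (I.addLine hw h).carrier := by
  have hwI' := hB.apply_comm_of_graded I.graded (mem_leftPerp.1 hwI)
  intro x hx y hy
  obtain ⟨u, hu, _, hx', rfl⟩ := Submodule.mem_sup.1 hx
  obtain ⟨a, rfl⟩ := Submodule.mem_span_singleton.1 hx'
  obtain ⟨v, hv, _, hy', rfl⟩ := Submodule.mem_sup.1 hy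
  obtain ⟨b, rfl⟩ := Submodule.mem_span_singleton.1 hy'
  simp [hI u hu v hv, mem_leftPerp.1 hwI v hv, hwI' u hu, hww]

theorem finrank_lt_addLine [FiniteDimensional K V] (hw : w ∈ L.grade i)
    (h : ∀ x, ∃ c : K, L.bracket x w - c • w ∈ I.carrier) (hwI : w ∉ I.carrier) :
    Module.finrank K I.carrier < Module.finrank K (I.addLine hw h).carrier := by
  refine Submodule.finrank_lt_finrank_of_lt (lt_of_le_of_ne le_sup_left fun e => hwI ?_)
  rw [e]
  exact Submodule.mem_sup_right (Submodule.mem_span_singleton_self w)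

theorem even_of_anisotropic [CharZero K] (hB : L.IsInvariantScalarProduct B)
    (hw : w ∈ L.grade i) (hww : B w w ≠ 0) : w ∈ L.grade 0 := by
  rcases zmodTwo_cases i with rfl | rfl
  · exact hw
  · have h := hB.supersymm 1 1 w w hw hw
    rw [superSign_one_one, neg_one_mul, eq_neg_iff_add_eq_zero, ← two_mul] at h
    exact absurd ((mul_eq_zero.1 h).resolve_left two_ne_zero) hww

/-- The weight of an anisotropic invariant line vanishes, since
`B([x, w], w) = B(x, [w, w]) = 0`. -/
theorem bracket_mem_of_anisotropic [CharZero K] (hB : L.IsInvariantScalarProduct B)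
    (hw : w ∈ L.grade i) (h : ∀ x, ∃ c : K, L.bracket x w - c • w ∈ I.carrier)
    (hwI : w ∈ (hB.perp I).carrier) (hww : B w w ≠ 0) (x : V) : L.bracket x w ∈ I.carrier := by
  obtain ⟨c, hc⟩ := h x
  have hw0 := hB.even_of_anisotropic hw hww
  have h1 := hB.apply_comm_of_graded I.graded (mem_leftPerp.1 hwI) _ hc
  have hself : L.bracket w w = 0 := by
    have e := L.bracket_skew 0 0 w w hw0 hw0
    rw [superSign_zero_left, one_smul, eq_neg_iff_add_eq_zero, ← two_smul K] at e
    exact (smul_eq_zero.1 e).resolve_left two_ne_zero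
  rw [map_sub, LinearMap.sub_apply, hB.invariant, hself, map_zero, map_smul,
    LinearMap.smul_apply, smul_eq_mul, zero_sub, neg_eq_zero] at h1
  rw [(mul_eq_zero.1 h1).resolve_right hww, zero_smul, sub_zero] at hc
  exact hc

/-- If `I^⊥ / I` has dimension at least `2`, it contains a homogeneous isotropic invariant line:
when the first invariant lines found are anisotropic, two orthogonal ones are killed by the action
and span an isotropic vector, because the field is algebraically closed. -/
theorem exists_isotropic_line [IsAlgClosed K] [CharZero K] [FiniteDimensional K V]
    (hB : L.IsInvariantScalarProduct B) (hL : L.HasInvariantLines)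
    (hdim : 2 * Module.finrank K I.carrier + 2 ≤ Module.finrank K V) :
    ∃ i, ∃ w ∈ L.grade i, w ∈ (hB.perp I).carrier ∧ w ∉ I.carrier ∧
      (∀ x, ∃ c : K, L.bracket x w - c • w ∈ I.carrier) ∧ B w w = 0 := by
  have hnot : ∀ P : L.GradedIdeal,
      Module.finrank K I.carrier < Module.finrank K P.carrier → ¬ P.carrier ≤ I.carrier :=
    fun P hlt hle => absurd (Submodule.finrank_mono hle) (not_le.2 hlt)
  have hperp : ∀ P : L.GradedIdeal, Module.finrank K P.carrier +
      Module.finrank K (hB.perp P).carrier = Module.finrank K V :=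
    fun P => finrank_add_finrank_leftPerp hB.nondegenerate P.carrier
  obtain ⟨i, w, hw, hwP, hwI, hwc⟩ := hL I (hB.perp I) (hnot _ (by
    have := hperp I
    omega))
  by_cases hww : B w w = 0
  · exact ⟨i, w, hw, hwP, hwI, hwc, hww⟩
  have hline : Module.finrank K (I.addLine hw hwc).carrier ≤ Module.finrank K I.carrier + 1 := by
    refine (Submodule.finrank_add_le_finrank_add_finrank _ _).trans ?_
    exact Nat.add_le_add_left ((finrank_span_le_card ({w} : Set V)).trans (by simp)) _
  obtain ⟨j, v, hv, hvP, hvI, hvc⟩ := hL I (hB.perp (I.addLine hw hwc)) (hnot _ (by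
    have := hperp (I.addLine hw hwc)
    omega))
  have hvI' : v ∈ (hB.perp I).carrier :=
    mem_leftPerp.2 fun y hy => mem_leftPerp.1 hvP y (Submodule.mem_sup_left hy)
  have hvw : B v w = 0 := mem_leftPerp.1 hvP w
    (Submodule.mem_sup_right (Submodule.mem_span_singleton_self w))
  by_cases hvv : B v v = 0
  · exact ⟨j, v, hv, hvI', hvI, hvc, hvv⟩
  have hw0 := hB.even_of_anisotropic hw hww
  have hv0 := hB.even_of_anisotropic hv hvv
  have hwv : B w v = 0 := by rw [hB.supersymm 0 0 w v hw0 hv0, hvw, mul_zero]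
  -- `c` solves `B(w, w) + c² B(v, v) = 0`
  obtain ⟨c, hc⟩ := IsAlgClosed.exists_pow_nat_eq (-(B w w) / B v v) (n := 2) two_pos
  refine ⟨0, w + c • v, Submodule.add_mem _ hw0 (Submodule.smul_mem _ c hv0),
    Submodule.add_mem _ hwP (Submodule.smul_mem _ c hvI'), fun hmem => hww ?_,
    fun x => ⟨0, ?_⟩, ?_⟩
  · have := hB.apply_comm_of_graded I.graded (mem_leftPerp.1 hwP) _ hmem
    simpa [hvw] using this
  · rw [zero_smul, sub_zero, map_add, map_smul]
    exact Submodule.add_mem _ (hB.bracket_mem_of_anisotropic hw hwc hwP hww x)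
      (Submodule.smul_mem _ c (hB.bracket_mem_of_anisotropic hv hvc hvI' hvv x))
  · simp only [map_add, map_smul, LinearMap.add_apply, LinearMap.smul_apply, smul_eq_mul, hvw, hwv]
    rw [eq_div_iff hvv] at hc
    linear_combination hc

theorem exists_isotropic_ideal [IsAlgClosed K] [CharZero K] [FiniteDimensional K V]
    (hB : L.IsInvariantScalarProduct B) (hL : L.HasInvariantLines) :
    ∃ I : L.GradedIdeal, IsTotallyIsotropic B I.carrier ∧
      Module.finrank K I.carrier = Module.finrank K V / 2 := by
  have key : ∀ n ≤ Module.finrank K V / 2, ∃ I : L.GradedIdeal,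
      IsTotallyIsotropic B I.carrier ∧ n ≤ Module.finrank K I.carrier := by
    intro n
    induction n with
    | zero =>
      refine fun _ => ⟨GradedIdeal.ofRight L ⊥ ?_ ?_, ?_, Nat.zero_le _⟩
      · rintro x hx i
        rw [(Submodule.mem_bot K).1 hx, map_zero]; exact Submodule.zero_mem _
      · rintro x hx j y -
        rw [(Submodule.mem_bot K).1 hx, map_zero]; exact Submodule.zero_mem _
      · intro x hx y _
        rw [(Submodule.mem_bot K).1 hx, map_zero, LinearMap.zero_apply]
    | succ n ih =>
      intro hn
      obtain ⟨I, hI, hnI⟩ := ih (by omega)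
      by_cases hlt : n + 1 ≤ Module.finrank K I.carrier
      · exact ⟨I, hI, hlt⟩
      obtain ⟨i, w, hw, hwP, hwI, hwc, hww⟩ := hB.exists_isotropic_line (I := I) hL (by omega)
      exact ⟨I.addLine hw hwc, hB.isTotallyIsotropic_addLine hI hw hwc hwP hww,
        lt_of_le_of_lt hnI (finrank_lt_addLine hw hwc hwI)⟩
  obtain ⟨I, hI, h⟩ := key _ le_rfl
  have := hI.two_mul_finrank_le hB.nondegenerate
  exact ⟨I, hI, by omega⟩

/-- In odd dimension, `I^⊥` is spanned by `I` and an even anisotropic vector `w` that acts trivially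
modulo `I`. -/
theorem exists_anisotropic [CharZero K] [FiniteDimensional K V]
    (hB : L.IsInvariantScalarProduct B) (hL : L.HasInvariantLines)
    (hI : IsTotallyIsotropic B I.carrier)
    (hdim : Module.finrank K V = 2 * Module.finrank K I.carrier + 1) :
    ∃ w ∈ L.grade 0, w ∈ (hB.perp I).carrier ∧ B w w ≠ 0 ∧ ∀ x, L.bracket x w ∈ I.carrier := by
  obtain ⟨i, w, hw, hwP, hwI, hwc⟩ := hL I (hB.perp I) (fun hle => by
    have h1 : Module.finrank K I.carrier + Module.finrank K (hB.perp I).carrier = _ :=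
      finrank_add_finrank_leftPerp hB.nondegenerate I.carrier
    have h2 := Submodule.finrank_mono hle
    omega)
  have hww : B w w ≠ 0 := by
    intro hww
    have h1 := (hB.isTotallyIsotropic_addLine hI hw hwc hwP hww).two_mul_finrank_le
      hB.nondegenerate
    have h2 := finrank_lt_addLine hw hwc hwI
    omega
  exact ⟨w, hB.even_of_anisotropic hw hww, hwP, hww,
    hB.bracket_mem_of_anisotropic hw hwc hwP hww⟩

end IsInvariantScalarProduct

end Invariant

/-! ### Lagrangian projections and `T*`-extensions -/

/-- `p` is a surjective morphism of Lie superalgebras from the quadratic Lie superalgebra `(L, B)`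
onto `M` whose kernel is totally isotropic of half the dimension. -/
structure IsLagrangianProj (L : LieSuperalgebra K V) (B : LinearMap.BilinForm K V)
    (M : LieSuperalgebra K W) (p : V →ₗ[K] W) : Prop where
  surjective : Function.Surjective p
  map_mem : ∀ i, ∀ x ∈ L.grade i, p x ∈ M.grade i
  map_bracket : ∀ x y, p (L.bracket x y) = M.bracket (p x) (p y)
  isotropic_ker : ∀ x y, p x = 0 → p y = 0 → B x y = 0
  finrank_eq : Module.finrank K V = 2 * Module.finrank K W

/-- `s` is a linear section of `p` that preserves degrees and has totally isotropic image. -/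
structure IsLagrangianSection (L : LieSuperalgebra K V) (B : LinearMap.BilinForm K V)
    (M : LieSuperalgebra K W) (p : V →ₗ[K] W) (s : W →ₗ[K] V) : Prop where
  map_mem : ∀ i, ∀ X ∈ M.grade i, s X ∈ L.grade i
  right_inv : ∀ X, p (s X) = X
  isotropic : ∀ X Y, B (s X) (s Y) = 0

variable {L : LieSuperalgebra K V} {B : LinearMap.BilinForm K V}
  {M : LieSuperalgebra K W} {p : V →ₗ[K] W} {s : W →ₗ[K] V}

theorem IsLagrangianProj.exists_graded_section (hp : L.IsLagrangianProj B M p) :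
    ∃ s : W →ₗ[K] V, (∀ X, p (s X) = X) ∧ ∀ i, ∀ X ∈ M.grade i, s X ∈ L.grade i := by
  obtain ⟨r, hr⟩ := p.exists_rightInverse_of_surjective (LinearMap.range_eq_top.2 hp.surjective)
  have hr' : ∀ X, p (r X) = X := fun X => LinearMap.congr_fun hr X
  refine ⟨L.proj 0 ∘ₗ r ∘ₗ M.proj 0 + L.proj 1 ∘ₗ r ∘ₗ M.proj 1, fun X => ?_, fun i X hX => ?_⟩
  · simp only [LinearMap.add_apply, LinearMap.comp_apply, map_add,
      L.map_proj M p hp.map_mem, hr', M.proj_of_mem (M.proj_mem _ X), M.proj_add_proj]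
  · rcases zmodTwo_cases i with rfl | rfl
    · simpa [M.proj_one_of_mem hX] using L.proj_mem 0 _
    · simpa [M.proj_zero_of_mem hX] using L.proj_mem 1 _

/-- A vector of the kernel that is orthogonal to a linear section is zero. -/
theorem IsLagrangianProj.eq_zero_of_orthogonal (hB : L.IsInvariantScalarProduct B)
    (hp : L.IsLagrangianProj B M p) (hs : ∀ X, p (s X) = X) {x : V} (hx : p x = 0)
    (h : ∀ X, B x (s X) = 0) : x = 0 := by
  refine hB.nondegenerate.1 x fun v => ?_
  have h1 := hp.isotropic_ker x (v - s (p v)) hx (by rw [map_sub, hs, sub_self])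
  rwa [map_sub, h, sub_zero] at h1

/-- A graded section can be corrected to a Lagrangian one: since `ker p` is dual to `W` through
`B`, there is `k : W → ker p` with `B(k X, s Y) = -B(s X, s Y) / 2`, and `s + k` has isotropic
image. -/
theorem IsLagrangianProj.exists_section [CharZero K] [FiniteDimensional K V]
    (hB : L.IsInvariantScalarProduct B) (hp : L.IsLagrangianProj B M p) :
    ∃ s : W →ₗ[K] V, L.IsLagrangianSection B M p s := by
  obtain ⟨s, hs, hsg⟩ := hp.exists_graded_section
  have : FiniteDimensional K W := Module.Finite.of_surjective p hp.surjective
  let ψ : LinearMap.ker p →ₗ[K] Module.Dual K W := s.dualMap ∘ₗ B ∘ₗ (LinearMap.ker p).subtype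
  have hψ : Function.Injective ψ := by
    rw [← LinearMap.ker_eq_bot, LinearMap.ker_eq_bot']
    intro x hx
    exact Subtype.ext (hp.eq_zero_of_orthogonal hB hs x.2 fun X => LinearMap.congr_fun hx X)
  have hdim : Module.finrank K (LinearMap.ker p) = Module.finrank K (Module.Dual K W) := by
    have h1 := p.finrank_range_add_finrank_ker
    rw [LinearMap.range_eq_top.2 hp.surjective, finrank_top, hp.finrank_eq] at h1
    rw [Subspace.dual_finrank_eq]
    omega
  let e := LinearMap.linearEquivOfInjective ψ hψ hdim
  let k : W →ₗ[K] V := (LinearMap.ker p).subtype ∘ₗ e.symm.toLinearMap ∘ₗ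
    ((-(1 / 2 : K)) • (s.dualMap ∘ₗ B ∘ₗ s))
  have hk : ∀ X Y, B (k X) (s Y) = -(1 / 2) * B (s X) (s Y) := by
    intro X Y
    have h1 : ψ (e.symm (((-(1 / 2 : K)) • (s.dualMap ∘ₗ B ∘ₗ s)) X)) = _ :=
      e.apply_symm_apply _
    exact LinearMap.congr_fun h1 Y
  have hpk : ∀ X, p (k X) = 0 := fun X => LinearMap.mem_ker.1 (e.symm _).2
  have hkg : ∀ i, ∀ X ∈ M.grade i, k X ∈ L.grade i := by
    intro i X hX
    -- the component of the wrong degree lies in the kernel and is orthogonal to the section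
    have h0 : L.proj (i + 1) (k X) = 0 := by
      refine hp.eq_zero_of_orthogonal hB hs (by rw [L.map_proj M p hp.map_mem, hpk, map_zero])
        fun Y => ?_
      rw [hB.apply_proj, ← M.map_proj L s hsg, hk,
        hB.apply_eq_zero _ (hsg i X hX) (hsg _ _ (M.proj_mem (i + 1) Y)), mul_zero]
      rw [add_assoc, zmodTwo_one_add_one, add_zero]
    rcases zmodTwo_cases i with rfl | rfl
    · rw [zero_add] at h0
      rw [← L.proj_add_proj (k X), h0, add_zero]
      exact L.proj_mem 0 _
    · rw [zmodTwo_one_add_one] at h0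
      rw [← L.proj_add_proj (k X), h0, zero_add]
      exact L.proj_mem 1 _
  refine ⟨s + k, fun i X hX => Submodule.add_mem _ (hsg i X hX) (hkg i X hX),
    fun X => by rw [LinearMap.add_apply, map_add, hs, hpk, add_zero], fun X Y => ?_⟩
  induction X using M.homogeneous_induction with
  | hadd X X' h h' => rw [map_add, map_add, LinearMap.add_apply, h, h', add_zero]
  | hom i X hX =>
    induction Y using M.homogeneous_induction with
    | hadd Y Y' h h' => rw [map_add, map_add, h, h', add_zero]
    | hom j Y hY =>
      simp only [LinearMap.add_apply, map_add]
      rw [hp.isotropic_ker _ _ (hpk X) (hpk Y), hk,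
        hB.supersymm i j _ _ (hsg i X hX) (hkg j Y hY), hk,
        hB.supersymm i j _ _ (hsg i X hX) (hsg j Y hY)]
      ring

/-- Pairing a kernel vector with the section only sees brackets modulo the kernel: `[s X, s Y]` may
be replaced by `s [X, Y]`. -/
theorem IsLagrangianSection.apply_bracket (hB : L.IsInvariantScalarProduct B)
    (hp : L.IsLagrangianProj B M p) (hs : L.IsLagrangianSection B M p s) {x : V} (hx : p x = 0)
    (X Y : W) : B (L.bracket x (s X)) (s Y) = B x (s (M.bracket X Y)) := by
  have h := hp.isotropic_ker x (L.bracket (s X) (s Y) - s (M.bracket X Y)) hx (by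
    rw [map_sub, hp.map_bracket, hs.right_inv, hs.right_inv, hs.right_inv, sub_self])
  rw [map_sub, sub_eq_zero] at h
  rw [hB.invariant, h]

/-- The bilinear map `(X, Y) ↦ B([s X, s Y], s ·)` attached to a linear section `s`. -/
def sectionCocycleMap (L : LieSuperalgebra K V) (B : LinearMap.BilinForm K V) (s : W →ₗ[K] V) :
    W →ₗ[K] W →ₗ[K] Module.Dual K W :=
  (L.bracket.compl₁₂ s s).compr₂ (s.dualMap ∘ₗ B)

theorem sectionCocycleMap_apply (X Y Z : W) :
    L.sectionCocycleMap B s X Y Z = B (L.bracket (s X) (s Y)) (s Z) := rfl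

/-- The terms `ω(X, [Y, Z])` and `π(X) ω(Y, Z)` of the cocycle identity add up to a double bracket
in `L`, so that this identity reduces to the Jacobi identity of `L`. -/
theorem IsLagrangianSection.cocycle_term (hB : L.IsInvariantScalarProduct B)
    (hp : L.IsLagrangianProj B M p) (hs : L.IsLagrangianSection B M p s) {i j k : ZMod 2}
    {X Y Z : W} (hX : X ∈ M.grade i) (hY : Y ∈ M.grade j) (hZ : Z ∈ M.grade k)
    (hω : L.sectionCocycleMap B s Y Z ∈ M.dualGrade (j + k)) (T : W) :
    L.sectionCocycleMap B s X (M.bracket Y Z) T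
        + M.coadjoint X (L.sectionCocycleMap B s Y Z) T =
      B (L.bracket (s X) (L.bracket (s Y) (s Z))) (s T) := by
  -- the component of `[s Y, s Z]` in the kernel
  have hd : p (L.bracket (s Y) (s Z) - s (M.bracket Y Z)) = 0 := by
    rw [map_sub, hp.map_bracket, hs.right_inv, hs.right_inv, hs.right_inv, sub_self]
  have h := hs.apply_bracket hB hp hd X T
  have hdg : L.bracket (s Y) (s Z) - s (M.bracket Y Z) ∈ L.grade (j + k) :=
    Submodule.sub_mem _ (L.bracket_mem _ _ _ _ (hs.map_mem _ _ hY) (hs.map_mem _ _ hZ))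
      (hs.map_mem _ _ (M.bracket_mem _ _ _ _ hY hZ))
  rw [L.bracket_skew _ _ _ _ hdg (hs.map_mem _ _ hX)] at h
  rw [M.coadjoint_apply_of_mem hX hω, sectionCocycleMap_apply, sectionCocycleMap_apply]
  simp only [map_sub, map_neg, map_smul, LinearMap.sub_apply, LinearMap.neg_apply,
    LinearMap.smul_apply, smul_eq_mul, hs.isotropic, sub_zero] at h
  rw [← h]
  rcases zmodTwo_cases i with rfl | rfl <;> rcases zmodTwo_cases (j + k) with e | e <;>
    simp only [e, superSign_zero_left, superSign_zero_right, superSign_one_one] <;> ring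

theorem IsLagrangianSection.sectionCocycleMap_mem (hB : L.IsInvariantScalarProduct B)
    (hs : L.IsLagrangianSection B M p s) {i j : ZMod 2}
    {X Y : W} (hX : X ∈ M.grade i) (hY : Y ∈ M.grade j) :
    L.sectionCocycleMap B s X Y ∈ M.dualGrade (i + j) := by
  refine M.mem_dualGrade.2 fun Z hZ => ?_
  refine hB.apply_eq_zero ?_
    (L.bracket_mem _ _ _ _ (hs.map_mem _ _ hX) (hs.map_mem _ _ hY)) (hs.map_mem _ _ hZ)
  rw [add_assoc (i + j), zmodTwo_one_add_one, add_zero]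

/-- The supercyclic cocycle `ω(X, Y)(Z) = B([s X, s Y], s Z)` of a Lagrangian section `s`. -/
def sectionCocycle (hB : L.IsInvariantScalarProduct B) (hp : L.IsLagrangianProj B M p)
    (hs : L.IsLagrangianSection B M p s) : M.SupercyclicCocycle where
  toMap := L.sectionCocycleMap B s
  even i j X Y hX hY := hs.sectionCocycleMap_mem hB hX hY
  skew i j X Y hX hY := by
    ext Z
    rw [LinearMap.neg_apply, LinearMap.smul_apply, sectionCocycleMap_apply,
      sectionCocycleMap_apply, L.bracket_skew _ _ _ _ (hs.map_mem _ _ hX) (hs.map_mem _ _ hY)]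
    simp
  cocycle i j k X Y Z hX hY hZ := by
    ext T
    have h1 := hs.cocycle_term hB hp hX hY hZ (hs.sectionCocycleMap_mem hB hY hZ) T
    have h2 := hs.cocycle_term hB hp hY hZ hX (hs.sectionCocycleMap_mem hB hZ hX) T
    have h3 := hs.cocycle_term hB hp hZ hX hY (hs.sectionCocycleMap_mem hB hX hY) T
    have hX' := hs.map_mem _ _ hX
    have hY' := hs.map_mem _ _ hY
    have hZ' := hs.map_mem _ _ hZ
    have hJ := L.jacobi _ _ _ _ _ _ hX' hY' hZ'
    rw [L.bracket_skew _ _ _ _ hX' hZ', L.bracket_skew _ _ _ _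
      (L.bracket_mem _ _ _ _ hX' hY') hZ'] at hJ
    have hJ' := congrArg (fun v => B v (s T)) hJ
    simp only [map_add, map_neg, map_smul, LinearMap.add_apply, LinearMap.neg_apply,
      LinearMap.smul_apply, smul_eq_mul] at hJ' ⊢
    rw [← h1, ← h2, ← h3] at hJ'
    rcases zmodTwo_cases i with rfl | rfl <;> rcases zmodTwo_cases j with rfl | rfl <;>
      rcases zmodTwo_cases k with rfl | rfl <;>
      simp only [superSign_zero_left, superSign_zero_right, superSign_one_one, add_zero, zero_add,
        zmodTwo_one_add_one, LinearMap.zero_apply] at hJ' ⊢ <;> linear_combination hJ'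
  supercyclic i j k X Y Z hX hY hZ := by
    have hX' := hs.map_mem _ _ hX
    have hY' := hs.map_mem _ _ hY
    have hZ' := hs.map_mem _ _ hZ
    rw [sectionCocycleMap_apply, sectionCocycleMap_apply, hB.invariant,
      hB.supersymm _ _ _ _ hX' (L.bracket_mem _ _ _ _ hY' hZ')]

/-- A quadratic Lie superalgebra with a Lagrangian projection onto `M` is isometric to a
`T*`-extension of `M`, by `v ↦ (p v, B(v, s ·))` for a Lagrangian section `s`. -/
theorem IsLagrangianProj.isIsometric_tStar [CharZero K] [FiniteDimensional K V]
    (hB : L.IsInvariantScalarProduct B) (hp : L.IsLagrangianProj B M p) :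
    ∃ ω : M.SupercyclicCocycle, L.IsIsometric B (M.tStar ω) M.tStarForm := by
  obtain ⟨s, hs⟩ := hp.exists_section hB
  have : FiniteDimensional K W := Module.Finite.of_surjective p hp.surjective
  let Ψ : V →ₗ[K] Module.Dual K W := s.dualMap ∘ₗ B
  have hΨ : ∀ x Z, Ψ x Z = B x (s Z) := fun _ _ => rfl
  have hΨg : ∀ i, ∀ x ∈ L.grade i, Ψ x ∈ M.dualGrade i := by
    intro i x hx
    refine M.mem_dualGrade.2 fun Z hZ => hB.apply_eq_zero ?_ hx (hs.map_mem _ _ hZ)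
    rw [add_assoc, zmodTwo_one_add_one, add_zero]
  have hinj : Function.Injective (p.prod Ψ) := by
    rw [← LinearMap.ker_eq_bot, LinearMap.ker_eq_bot']
    intro x hx
    exact hp.eq_zero_of_orthogonal hB hs.right_inv (congrArg Prod.fst hx)
      fun X => LinearMap.congr_fun (congrArg Prod.snd hx) X
  have hdim : Module.finrank K V = Module.finrank K (W × Module.Dual K W) := by
    rw [Module.finrank_prod, Subspace.dual_finrank_eq, hp.finrank_eq, two_mul]
  have hker : ∀ x, p (x - s (p x)) = 0 := fun x => by rw [map_sub, hs.right_inv, sub_self]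
  refine ⟨sectionCocycle hB hp hs, LinearMap.linearEquivOfInjective _ hinj hdim,
    fun i x hx => ⟨hp.map_mem i x hx, hΨg i x hx⟩, fun x y => ?_, fun x y => ?_⟩
  · change (p.prod Ψ) (L.bracket x y) = M.tStarBracket _ ((p.prod Ψ) x) ((p.prod Ψ) y)
    induction x using L.homogeneous_induction with
    | hadd x x' h h' => simp only [map_add, LinearMap.add_apply, h, h']
    | hom i x hx =>
      induction y using L.homogeneous_induction with
      | hadd y y' h h' => simp only [map_add, h, h']
      | hom j y hy =>
        have hpx := hp.map_mem i x hx
        have hpy := hp.map_mem j y hy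
        rw [M.tStarBracket_apply_of_mem _ (i := i) (j := j) (hΨg i x hx) hpy]
        refine Prod.ext (hp.map_bracket x y) (LinearMap.ext fun Z => ?_)
        simp only [LinearMap.prod_apply, Function.prod_apply]
        rw [LinearMap.sub_apply, LinearMap.add_apply, LinearMap.smul_apply,
          M.coadjoint_apply_of_mem hpx (hΨg j y hy), M.coadjoint_apply_of_mem hpy (hΨg i x hx),
          hΨ, hΨ, hΨ]
        change _ = B (L.bracket (s (p x)) (s (p y))) (s Z) + _ - _
        -- split `x` and `y` into their components in the section and in the kernel
        have h1 := hs.apply_bracket hB hp (hker x) (p y) Z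
        have h2 := hs.apply_bracket hB hp (hker y) (p x) Z
        have h3 : B (L.bracket (x - s (p x)) (y - s (p y))) (s Z) = 0 := by
          rw [hB.invariant]
          refine hp.isotropic_ker _ _ (hker x) ?_
          rw [hp.map_bracket, hker, map_zero, LinearMap.zero_apply]
        have h4 := L.bracket_skew j i (y - s (p y)) (s (p x))
          (Submodule.sub_mem _ hy (hs.map_mem _ _ hpy)) (hs.map_mem _ _ hpx)
        rw [h4] at h2
        simp only [map_sub, map_neg, map_smul, LinearMap.sub_apply, LinearMap.neg_apply,
          LinearMap.smul_apply, smul_eq_mul, hs.isotropic, sub_zero] at h1 h2 h3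
        rw [← h1, ← h2]
        rcases zmodTwo_cases i with rfl | rfl <;> rcases zmodTwo_cases j with rfl | rfl <;>
          simp only [superSign_zero_left, superSign_zero_right, superSign_one_one, smul_eq_mul] <;>
          linear_combination h3
  · change M.tStarForm ((p.prod Ψ) x) ((p.prod Ψ) y) = B x y
    induction x using L.homogeneous_induction with
    | hadd x x' h h' => simp only [map_add, LinearMap.add_apply, h, h']
    | hom i x hx =>
      induction y using L.homogeneous_induction with
      | hadd y y' h h' => simp only [map_add, h, h']
      | hom j y hy =>
        have hpx := hp.map_mem i x hx
        rw [M.tStarForm_apply_of_mem (i := i) (j := j) hpx (hΨg j y hy)]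
        simp only [LinearMap.prod_apply, Function.prod_apply]
        rw [hΨ, hΨ, ← hB.supersymm i j _ _ (hs.map_mem _ _ hpx) hy]
        have h := hp.isotropic_ker _ _ (hker x) (hker y)
        simp only [map_sub, LinearMap.sub_apply, hs.isotropic] at h
        linear_combination -h

/-! ### Orthogonal extension by a central line -/

/-- The Lie superalgebra `L × K e` with `e` even and central. -/
def centralLine (L : LieSuperalgebra K V) : LieSuperalgebra K (V × K) where
  grade i := (L.grade i).prod (if i = 0 then ⊤ else ⊥)
  isCompl_grade := by
    refine ⟨?_, ?_⟩
    · rw [Submodule.disjoint_def]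
      rintro ⟨x, t⟩ ⟨hx0, -⟩ ⟨hx1, ht1⟩
      exact Prod.ext (Submodule.disjoint_def.1 L.isCompl_grade.disjoint x hx0 hx1)
        (by simpa using ht1)
    · rw [codisjoint_iff, eq_top_iff]
      rintro ⟨x, t⟩ _
      rw [Submodule.mem_sup]
      exact ⟨(L.proj 0 x, t), ⟨L.proj_mem 0 x, by simp⟩, (L.proj 1 x, 0),
        ⟨L.proj_mem 1 x, by simp⟩, Prod.ext (L.proj_add_proj x) (add_zero t)⟩
  bracket := (L.bracket.compl₁₂ (LinearMap.fst K V K) (LinearMap.fst K V K)).compr₂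
    (LinearMap.inl K V K)
  bracket_mem i j x y hx hy := ⟨L.bracket_mem i j _ _ hx.1 hy.1, Submodule.zero_mem _⟩
  bracket_skew i j x y hx hy := by
    refine Prod.ext (L.bracket_skew i j _ _ hx.1 hy.1) ?_
    simp
  jacobi i j k x y z hx hy hz := by
    refine Prod.ext (L.jacobi i j k _ _ _ hx.1 hy.1 hz.1) ?_
    simp

theorem centralLine_bracket (L : LieSuperalgebra K V) (x y : V × K) :
    L.centralLine.bracket x y = (L.bracket x.1 y.1, 0) := rfl

/-- The form on `V × K e` extending `B`, with `e` orthogonal to `V` and `B(e, e) = a`. -/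
def centralLineForm (B : LinearMap.BilinForm K V) (a : K) : LinearMap.BilinForm K (V × K) :=
  B.compl₁₂ (LinearMap.fst K V K) (LinearMap.fst K V K) +
    a • (LinearMap.mul K K).compl₁₂ (LinearMap.snd K V K) (LinearMap.snd K V K)

theorem centralLineForm_apply (B : LinearMap.BilinForm K V) (a : K) (x y : V × K) :
    centralLineForm B a x y = B x.1 y.1 + a * (x.2 * y.2) := rfl

theorem IsInvariantScalarProduct.centralLine {L : LieSuperalgebra K V}
    {B : LinearMap.BilinForm K V} (hB : L.IsInvariantScalarProduct B) {a : K} (ha : a ≠ 0) :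
    L.centralLine.IsInvariantScalarProduct (centralLineForm B a) where
  even x hx y hy := by
    have h : y.2 = 0 := by simpa using hy.2
    rw [centralLineForm_apply, hB.even _ hx.1 _ hy.1, h, mul_zero, mul_zero, add_zero]
  supersymm i j x y hx hy := by
    rw [centralLineForm_apply, centralLineForm_apply, hB.supersymm i j _ _ hx.1 hy.1]
    have hx2 := hx.2
    have hy2 := hy.2
    rcases zmodTwo_cases i with rfl | rfl <;> rcases zmodTwo_cases j with rfl | rfl <;>
      simp at hx2 hy2 <;>
      simp [hx2, hy2, superSign_zero_left, superSign_zero_right, mul_comm]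
  invariant x y z := by
    simp [centralLineForm_apply, centralLine_bracket, hB.invariant]
  nondegenerate := by
    refine ⟨fun x h => Prod.ext ?_ ?_, fun x h => Prod.ext ?_ ?_⟩
    · exact hB.nondegenerate.1 _ fun v => by simpa [centralLineForm_apply] using h (v, 0)
    · simpa [centralLineForm_apply, ha] using h (0, 1)
    · exact hB.nondegenerate.2 _ fun v => by simpa [centralLineForm_apply] using h (v, 0)
    · simpa [centralLineForm_apply, ha] using h (0, 1)

/-! ### Isometries onto quotients and ideals -/

section Quotient

variable {L : LieSuperalgebra K V} {B : LinearMap.BilinForm K V} {I : L.GradedIdeal}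

theorem isLagrangianProj_mkQ [FiniteDimensional K V] (hI : IsTotallyIsotropic B I.carrier)
    (hdim : Module.finrank K V = 2 * Module.finrank K I.carrier) :
    L.IsLagrangianProj B (L.quotient I) I.carrier.mkQ where
  surjective := I.carrier.mkQ_surjective
  map_mem _ x hx := ⟨x, hx, rfl⟩
  map_bracket _ _ := rfl
  isotropic_ker x y hx hy := hI x ((Submodule.Quotient.mk_eq_zero _).1 hx) y
    ((Submodule.Quotient.mk_eq_zero _).1 hy)
  finrank_eq := by
    have := I.carrier.finrank_quotient_add_finrank
    omega

/-- If `w ∈ I^⊥` acts trivially modulo `I`, then `(v, t) ↦ v - t w mod I` is a Lagrangian projection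
of `L × K e`, where `B(e, e) = -B(w, w)`: its kernel is spanned by `I` and the isotropic vector
`w + e`. -/
theorem isLagrangianProj_centralLine [FiniteDimensional K V] (hB : L.IsInvariantScalarProduct B)
    (hI : IsTotallyIsotropic B I.carrier)
    (hdim : Module.finrank K V = 2 * Module.finrank K I.carrier + 1) {w : V}
    (hw : w ∈ L.grade 0) (hwP : w ∈ (hB.perp I).carrier)
    (hwc : ∀ x, L.bracket x w ∈ I.carrier) :
    L.centralLine.IsLagrangianProj (centralLineForm B (-B w w)) (L.quotient I)
      (I.carrier.mkQ ∘ₗ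
        (LinearMap.fst K V K - (LinearMap.snd K V K).smulRight w)) where
  surjective := by
    intro X
    obtain ⟨x, rfl⟩ := I.carrier.mkQ_surjective X
    exact ⟨(x, 0), by simp⟩
  map_mem i x hx := by
    refine ⟨x.1 - x.2 • w, Submodule.sub_mem _ hx.1 ?_, rfl⟩
    have hx2 := hx.2
    rcases zmodTwo_cases i with rfl | rfl
    · exact Submodule.smul_mem _ _ hw
    · have h : x.2 = 0 := by simpa using hx2
      rw [h, zero_smul]
      exact Submodule.zero_mem _
  map_bracket x y := by
    have hwc' : ∀ z, L.bracket w z ∈ I.carrier := by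
      intro z
      induction z using L.homogeneous_induction with
      | hadd z z' h h' => simpa using I.carrier.add_mem h h'
      | hom j z hz => exact L.bracket_mem_swap _ hz hw (hwc z)
    change I.carrier.mkQ (L.bracket x.1 y.1 - (0 : K) • w) =
      I.carrier.mkQ (L.bracket (x.1 - x.2 • w) (y.1 - y.2 • w))
    rw [← sub_eq_zero, ← map_sub, Submodule.mkQ_apply, Submodule.Quotient.mk_eq_zero]
    have e : L.bracket x.1 y.1 - (0 : K) • w - L.bracket (x.1 - x.2 • w) (y.1 - y.2 • w) =
        y.2 • L.bracket (x.1 - x.2 • w) w + x.2 • L.bracket w y.1 := by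
      simp only [map_sub, map_smul, LinearMap.sub_apply, LinearMap.smul_apply]
      module
    rw [e]
    exact Submodule.add_mem _ (Submodule.smul_mem _ _ (hwc _)) (Submodule.smul_mem _ _ (hwc' _))
  isotropic_ker x y hx hy := by
    have hx' : x.1 - x.2 • w ∈ I.carrier := (Submodule.Quotient.mk_eq_zero _).1 hx
    have hy' : y.1 - y.2 • w ∈ I.carrier := (Submodule.Quotient.mk_eq_zero _).1 hy
    have h1 := hI _ hx' _ hy'
    have h2 := mem_leftPerp.1 hwP _ hy'
    have h3 := hB.apply_comm_of_graded I.graded (mem_leftPerp.1 hwP) _ hx'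
    simp only [map_sub, map_smul, LinearMap.sub_apply, LinearMap.smul_apply, smul_eq_mul]
      at h1 h2 h3
    rw [centralLineForm_apply]
    linear_combination h1 + x.2 * h2 + y.2 * h3
  finrank_eq := by
    have := I.carrier.finrank_quotient_add_finrank
    rw [Module.finrank_prod, Module.finrank_self]
    omega

/-- If `L × K e` is isometric to `L'`, then `L` is isometric to an ideal of codimension `1` of
`L'`. -/
theorem exists_ideal_of_isIsometric_centralLine [FiniteDimensional K V]
    (hB : L.IsInvariantScalarProduct B) {a : K} {L' : LieSuperalgebra K W}
    {B' : LinearMap.BilinForm K W}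
    (h : L.centralLine.IsIsometric (centralLineForm B a) L' B') :
    ∃ J : L'.GradedIdeal, Module.finrank K (W ⧸ J.carrier) = 1 ∧
      (B'.restrict J.carrier).Nondegenerate ∧
      L.IsIsometric B J.toLieSuperalgebra (B'.restrict J.carrier) := by
  obtain ⟨φ, hφg, hφb, hφB⟩ := h
  let ι : V →ₗ[K] W := φ.toLinearMap ∘ₗ LinearMap.inl K V K
  have hι : Function.Injective ι := φ.injective.comp LinearMap.inl_injective
  have hιg : ∀ i, ∀ x ∈ L.grade i, ι x ∈ L'.grade i :=
    fun i x hx => hφg i _ ⟨hx, Submodule.zero_mem _⟩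
  have hιb : ∀ x y, ι (L.bracket x y) = L'.bracket (ι x) (ι y) := fun x y => hφb (x, 0) (y, 0)
  have hιB : ∀ x y, B' (ι x) (ι y) = B x y := by
    intro x y
    have := hφB (x, 0) (y, 0)
    rw [centralLineForm_apply] at this
    simpa [ι] using this
  let J : L'.GradedIdeal := GradedIdeal.ofRight L' (LinearMap.range ι)
    (by
      rintro _ ⟨x, rfl⟩ i
      exact ⟨L.proj i x, L.map_proj L' ι hιg i x⟩)
    (by
      rintro _ ⟨x, rfl⟩ j y -
      obtain ⟨z, rfl⟩ := φ.surjective y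
      exact ⟨L.bracket x z.1, hφb (x, 0) z⟩)
  let e : V ≃ₗ[K] J.carrier := LinearEquiv.ofInjective ι hι
  have he : ∀ x y, B'.restrict J.carrier (e x) (e y) = B x y := hιB
  refine ⟨J, ?_, ⟨fun x hx => ?_, fun x hx => ?_⟩, e, hιg,
    fun x y => Subtype.ext (hιb x y), he⟩
  · have := Module.Finite.equiv φ
    have h1 := J.carrier.finrank_quotient_add_finrank
    rw [← e.finrank_eq, ← φ.finrank_eq, Module.finrank_prod, Module.finrank_self] at h1
    omega
  · obtain ⟨x, rfl⟩ := e.surjective x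
    rw [hB.nondegenerate.1 x fun y => by rw [← he]; exact hx _, map_zero]
  · obtain ⟨x, rfl⟩ := e.surjective x
    rw [hB.nondegenerate.2 x fun y => by rw [← he]; exact hx _, map_zero]

end Quotient

end LieSuperalgebra

theorem mainTheorem1 {K V : Type*} [Field K] [IsAlgClosed K] [CharZero K]
    [AddCommGroup V] [Module K V] [FiniteDimensional K V]
    (L : LieSuperalgebra K V) (B : LinearMap.BilinForm K V)
    (hB : L.IsInvariantScalarProduct B)
    (hL : L.IsNilpotent ∨
      (L.IsSolvable ∧
        L.bracketSpan (L.grade 1) (L.grade 1) ≤ L.bracketSpan (L.grade 0) (L.grade 0))) :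
    ∃ I : L.GradedIdeal,
      Module.finrank K I.carrier = Module.finrank K V / 2 ∧
      Maximal (LieSuperalgebra.IsTotallyIsotropic B) I.carrier ∧
      (Even (Module.finrank K V) →
        ∃ ω : (L.quotient I).SupercyclicCocycle,
          L.IsIsometric B ((L.quotient I).tStar ω) (L.quotient I).tStarForm) ∧
      (Odd (Module.finrank K V) →
        ∃ (ω : (L.quotient I).SupercyclicCocycle) (J : ((L.quotient I).tStar ω).GradedIdeal),
          Module.finrank K
            (((V ⧸ I.carrier) × Module.Dual K (V ⧸ I.carrier)) ⧸ J.carrier) = 1 ∧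
          ((L.quotient I).tStarForm.restrict J.carrier).Nondegenerate ∧
          L.IsIsometric B J.toLieSuperalgebra ((L.quotient I).tStarForm.restrict J.carrier)) := by
  have hinv : L.HasInvariantLines :=
    hL.elim (fun h => h.hasInvariantLines) fun h => h.1.hasInvariantLines h.2
  obtain ⟨I, hI, hdim⟩ := hB.exists_isotropic_ideal hinv
  refine ⟨I, hdim, hI.maximal_of_finrank hB.nondegenerate hdim, fun heven => ?_, fun hodd => ?_⟩
  · refine (LieSuperalgebra.isLagrangianProj_mkQ hI ?_).isIsometric_tStar hB
    obtain ⟨m, hm⟩ := heven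
    omega
  · have hdim' : Module.finrank K V = 2 * Module.finrank K I.carrier + 1 := by
      obtain ⟨m, hm⟩ := hodd
      omega
    obtain ⟨w, hw, hwP, hww, hwc⟩ := hB.exists_anisotropic hinv hI hdim'
    obtain ⟨ω, hω⟩ := (LieSuperalgebra.isLagrangianProj_centralLine hB hI hdim' hw hwP
      hwc).isIsometric_tStar (hB.centralLine (neg_ne_zero.2 hww))
    exact ⟨ω, LieSuperalgebra.exists_ideal_of_isIsometric_centralLine hB hω⟩
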